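/- Let $c\in\mathbb{C}$ and let $f$ be a meromorphic function on $\mathbb{C}$ of finite order, i.e. $\limsup_{r\to\infty}\frac{\log^+ T(r,f)}{\log r}<\infty$, where $T(r,f)$ is the Nevanlinna characteristic of $f$. Suppose that $\Delta_c f(z):=f(z+c)-f(z)$ does not vanish identically. A value $a\in\mathbb{C}\cup\{\infty\}$ is called \emph{completely paired} for $f$ with the separation $c$ if, whenever $f(z)=a$, then $f(z+c)=a$ or $f(z-c)=a$ with the same multiplicity as at $z$ (for $a=\infty$ the $a$-points are the poles of $f$, counted with their order; a value that $f$ does not take is completely paired). Then at most four values $a\in\mathbb{C}\cup\{\infty\}$ are completely paired for $f$ with the separation $c$. -/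

import Mathlib

open Filter

noncomputable section

/-- The order of growth `limsup_{r → ∞} log⁺ T(r, f) / log r` of a meromorphic function `f`, where
`T(r, f)` is the Nevanlinna characteristic. -/
def growthOrder (f : ℂ → ℂ) : EReal :=
  limsup (fun r : ℝ ↦
    ((Real.posLog (ValueDistribution.characteristic f ⊤ r) / Real.log r : ℝ) : EReal)) atTop

/-- `f` is of finite order. -/
def IsOfFiniteOrder (f : ℂ → ℂ) : Prop := growthOrder f < ⊤

/-- The exact difference `Δ_c f (z) = f (z + c) - f z`. -/
def exactDifference (c : ℂ) (f : ℂ → ℂ) : ℂ → ℂ := fun z ↦ f (z + c) - f z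

/-- The multiplicity of `z` as an `a`-point of the meromorphic function `f`, for a value `a` in the
extended complex plane `WithTop ℂ`, with `⊤` as the point at infinity. It is `0` if `z` is not an
`a`-point. For finite `a` it is the order of vanishing of `f - a` at `z` (infinite if `f` is the
constant `a` near `z`), for `a = ⊤` it is the order of the pole. As it is defined through the order
of a meromorphic function, it does not depend on the values assigned to `f` at its singularities. -/
def valueMultiplicity (f : ℂ → ℂ) : WithTop ℂ → ℂ → ℕ∞
  | ⊤, z => ((-(meromorphicOrderAt f z).untop₀).toNat : ℕ∞)
  | (a : ℂ), z => WithTop.map Int.toNat (meromorphicOrderAt (fun w ↦ f w - a) z)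

/-- The value `a` of the extended plane is completely paired for `f` with the separation `c`:
whenever `z` is an `a`-point of `f`, then `z + c` or `z - c` is an `a`-point of `f` of the same
multiplicity. -/
def IsCompletelyPaired (f : ℂ → ℂ) (c : ℂ) (a : WithTop ℂ) : Prop :=
  ∀ z : ℂ, valueMultiplicity f a z ≠ 0 →
    valueMultiplicity f a (z + c) = valueMultiplicity f a z ∨
      valueMultiplicity f a (z - c) = valueMultiplicity f a z

end

/-! The proof is Nevanlinna theory for the difference operator. Write T for the characteristic of f,
N(a) for the counting function of the a-points, and P(a) for the counting function of the points z
at which both z and z + c are a-points, with the smaller multiplicity. For a finite set A of finite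
values, `leUpTo_secondMainTheorem` gives (|A| - 1) T + P(∞) + ∑ P(a) ≤ ∑ N(a) + N(∞) + o(T). The
terms P(a) enter because Δ_c f vanishes wherever f takes the same finite value at z and z + c, while
common poles at z and z + c lower the pole count of Δ_c f.

If a is completely paired, every a-point starts or ends a pair, so N(a) ≤ 2 P(a) + o(T)
(`leUpTo_logCounting_pairDivisor`). Suppose five values are paired. If ∞ is one of them, then |A| =
4 and 3T ≤ (4/2) T + (1/2) T + o(T); otherwise |A| = 5 and 4T ≤ (5/2) T + T + o(T). Both are absurd,
since T → ∞.

Two estimates carry the analysis: the proximity function of (f(z+c) - a)/(f(z) - a) is o(T)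
(`proximity_div_le_factor_mul`), and translation changes a counting function by o(T)
(`exists_logCounting_translateAdd_le`). Both bound the error at radius r by quantities at radius 4r.
Finite order supplies arbitrarily large r with T(4r) ≤ K T(r) (`exists_isGoodRadii`), and all
asymptotics are taken along a filter of such radii. -/

namespace Real

/-- The difference exp x + exp (-x) - 2 is (2 sinh (x/2))², and sinh y ≥ y for y ≥ 0. -/
lemma sq_add_two_le_exp_add_exp_neg {x : ℝ} (hx : 0 ≤ x) : x ^ 2 + 2 ≤ exp x + exp (-x) := by
  have h := self_le_sinh_iff.2 (show 0 ≤ x / 2 by linarith)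
  rw [sinh_eq] at h
  have e1 : exp x = exp (x / 2) ^ 2 := by rw [← exp_nat_mul]; congr 1; push_cast; ring
  have e2 : exp (-x) = exp (-(x / 2)) ^ 2 := by rw [← exp_nat_mul]; congr 1; push_cast; ring
  have e3 : exp (x / 2) * exp (-(x / 2)) = 1 := by rw [← exp_add]; simp
  nlinarith

end Real

/-! ### Circle averages of log ‖z - a‖ and its regularisation. -/

section LogarithmicKernel

open Real Metric Set

/-- The difference of `log (‖z - a‖ ^ 2 + s ^ 2)` and `log (‖z - a‖ ^ 2)`. -/
noncomputable def smoothedLogDifference (s : ℝ) (a z : ℂ) : ℝ :=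
  log (‖z - a‖ ^ 2 + s ^ 2) - 2 * log ‖z - a‖

lemma circleIntegrable_log_norm_sub (a c : ℂ) (r : ℝ) :
    CircleIntegrable (fun z ↦ log ‖z - a‖) c r :=
  MeromorphicOn.circleIntegrable_log_norm (f := fun z ↦ z - a) (fun z _ ↦ by fun_prop)

lemma continuous_log_norm_sub_sq_add {s : ℝ} (hs : 0 < s) (a : ℂ) :
    Continuous (fun z : ℂ ↦ log (‖z - a‖ ^ 2 + s ^ 2)) :=
  Continuous.log (by fun_prop) (fun z ↦ by positivity)

lemma circleIntegrable_smoothedLogDifference {s : ℝ} (hs : 0 < s) (a c : ℂ) (r : ℝ) :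
    CircleIntegrable (smoothedLogDifference s a) c r :=
  CircleIntegrable.sub (continuous_log_norm_sub_sq_add hs a).continuousOn.circleIntegrable'
    (CircleIntegrable.const_smul (a := (2 : ℝ)) (circleIntegrable_log_norm_sub a c r))

/-- A contraction factor `t` moving `a` into the disc of radius `r`, such that
`‖z - t * a‖ ^ 2 / t` dominates `‖z - a‖ ^ 2 + s ^ 2` on the circle of radius `r`. -/
lemma exists_contraction_factor {r s A : ℝ} (hr : 0 < r) (hs : 0 < s) (hA : 0 ≤ A) :
    ∃ t > 0, t * A ≤ r ∧ r ^ 2 + A ^ 2 + s ^ 2 ≤ r ^ 2 / t + t * A ^ 2 ∧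
      2 * log r - log t ≤ s / r + 2 * (log r + log⁺ (r⁻¹ * A)) := by
  rcases le_or_gt A r with h | h
  · have key := sq_add_two_le_exp_add_exp_neg (div_nonneg hs.le hr.le)
    have h1 : exp (-(s / r)) ≤ 1 := exp_le_one_iff.2 (by have := div_pos hs hr; linarith)
    -- With x = s / r, the gap in the second inequality is r²(eˣ + e⁻ˣ - 2) - s² + (r² - A²)(1 -
    -- e⁻ˣ), and both parts are nonnegative.
    refine ⟨exp (-(s / r)), exp_pos _, ?_, ?_, ?_⟩
    · nlinarith [exp_pos (-(s / r))]
    · have e1 : r ^ 2 / exp (-(s / r)) = r ^ 2 * exp (s / r) := by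
        rw [exp_neg]; field_simp
      have e2 : s ^ 2 = r ^ 2 * (s / r) ^ 2 := by field_simp
      have h2 : A ^ 2 ≤ r ^ 2 := by gcongr
      rw [e1, e2]
      nlinarith [mul_nonneg (sub_nonneg.2 h1) (sub_nonneg.2 h2),
        mul_le_mul_of_nonneg_left key (sq_nonneg r)]
    · rw [log_exp]
      have : 0 ≤ log⁺ (r⁻¹ * A) := posLog_nonneg
      linarith
  · have hA' : 0 < A := hr.trans h
    have key := sq_add_two_le_exp_add_exp_neg (div_nonneg hs.le hA)
    have h1 : exp (-(s / A)) ≤ 1 := exp_le_one_iff.2 (by have := div_pos hs hA'; linarith)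
    -- The factor r² / A² reflects an outer point in the circle; the exponential makes room for s²,
    -- as in the first case with r and A exchanged.
    refine ⟨r ^ 2 / A ^ 2 * exp (-(s / A)), by positivity, ?_, ?_, ?_⟩
    · calc r ^ 2 / A ^ 2 * exp (-(s / A)) * A ≤ r ^ 2 / A ^ 2 * 1 * A := by gcongr
        _ = r * (r / A) := by field_simp
        _ ≤ r * 1 := by
          gcongr
          exact (div_le_one hA').2 h.le
        _ = r := mul_one r
    · have e1 : r ^ 2 / (r ^ 2 / A ^ 2 * exp (-(s / A))) = A ^ 2 * exp (s / A) := by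
        rw [exp_neg]; field_simp
      have e2 : s ^ 2 = A ^ 2 * (s / A) ^ 2 := by field_simp
      have e3 : r ^ 2 / A ^ 2 * exp (-(s / A)) * A ^ 2 = r ^ 2 * exp (-(s / A)) := by field_simp
      have h2 : r ^ 2 ≤ A ^ 2 := by gcongr
      rw [e1, e2, e3]
      nlinarith [mul_nonneg (sub_nonneg.2 h1) (sub_nonneg.2 h2),
        mul_le_mul_of_nonneg_left key (sq_nonneg A)]
    · rw [log_mul (by positivity) (by positivity), log_exp, log_div (by positivity) (by positivity),
        log_pow, log_pow]
      have h2 : log (r⁻¹ * A) ≤ log⁺ (r⁻¹ * A) := le_max_right _ _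
      rw [log_mul (by positivity) (by positivity), log_inv] at h2
      have h3 : s / A ≤ s / r := by gcongr
      push_cast
      linarith

/-- Replacing a by t * a in the closed disc makes the mean of log ‖z - t * a‖ exactly log r, so only
log t remains to be controlled. The bound is uniform in a, even for a on the circle. -/
lemma circleAverage_smoothedLogDifference_le {r s : ℝ} (hr : 0 < r) (hs : 0 < s) (a : ℂ) :
    circleAverage (smoothedLogDifference s a) 0 r ≤ s / r := by
  obtain ⟨t, ht, hta, hle, hlog⟩ := exists_contraction_factor hr hs (norm_nonneg a)
  have hpoint : ∀ z ∈ sphere (0 : ℂ) |r|,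
      log (‖z - a‖ ^ 2 + s ^ 2) ≤ -log t + 2 * log ‖z - t * a‖ := by
    intro z hz
    have hz' : ‖z‖ = r := by simpa [abs_of_pos hr] using hz
    have e1 : ‖z - a‖ ^ 2 = r ^ 2 + ‖a‖ ^ 2 - 2 * (z * (starRingEnd ℂ) a).re := by
      rw [← Complex.normSq_eq_norm_sq, Complex.normSq_sub, Complex.normSq_eq_norm_sq,
        Complex.normSq_eq_norm_sq, hz']
    have e2 : ‖z - t * a‖ ^ 2 = r ^ 2 + t ^ 2 * ‖a‖ ^ 2
        - 2 * (t * (z * (starRingEnd ℂ) a).re) := by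
      rw [← Complex.normSq_eq_norm_sq, Complex.normSq_sub, Complex.normSq_eq_norm_sq,
        Complex.normSq_eq_norm_sq, hz', norm_mul, Complex.norm_real, norm_of_nonneg ht.le, mul_pow]
      simp
      ring
    have h3 : ‖z - a‖ ^ 2 + s ^ 2 ≤ t⁻¹ * ‖z - t * a‖ ^ 2 := by
      have : t⁻¹ * ‖z - t * a‖ ^ 2
          = r ^ 2 / t + t * ‖a‖ ^ 2 - 2 * (z * (starRingEnd ℂ) a).re := by
        rw [e2]; field_simp
      rw [this, e1]
      linarith
    have h4 : 0 < ‖z - a‖ ^ 2 + s ^ 2 := by positivity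
    have h5 : ‖z - t * a‖ ≠ 0 := by
      intro h
      rw [h] at h3
      norm_num at h3
      linarith
    calc log (‖z - a‖ ^ 2 + s ^ 2) ≤ log (t⁻¹ * ‖z - t * a‖ ^ 2) := log_le_log h4 h3
      _ = _ := by
        rw [log_mul (by positivity) (by positivity), log_inv, log_pow]
        norm_num
  have hI1 := circleIntegrable_log_norm_sub a 0 r
  have hI2 := circleIntegrable_log_norm_sub (t * a) 0 r
  have hI2' : CircleIntegrable (fun z ↦ 2 * log ‖z - t * a‖) 0 r :=
    hI2.const_smul (a := (2 : ℝ))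
  have hC : CircleIntegrable (fun z : ℂ ↦ log (‖z - a‖ ^ 2 + s ^ 2)) 0 r :=
    (continuous_log_norm_sub_sq_add hs a).continuousOn.circleIntegrable'
  have h1 : circleAverage (fun z : ℂ ↦ log (‖z - a‖ ^ 2 + s ^ 2)) 0 r ≤ -log t + 2 * log r := by
    calc _ ≤ circleAverage (fun z ↦ -log t + 2 * log ‖z - t * a‖) 0 r :=
          circleAverage_mono hC ((circleIntegrable_const _ 0 r).add hI2') hpoint
      _ = -log t + 2 * log r := by
        rw [circleAverage_fun_add (circleIntegrable_const _ 0 r) hI2', circleAverage_const]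
        congr 1
        simp_rw [← smul_eq_mul (a := (2 : ℝ))]
        rw [circleAverage_fun_smul, circleAverage_log_norm_sub_const_of_mem_closedBall]
        simpa [abs_of_pos hr, abs_of_pos ht] using hta
  have h2 : circleAverage (smoothedLogDifference s a) 0 r
      = circleAverage (fun z : ℂ ↦ log (‖z - a‖ ^ 2 + s ^ 2)) 0 r
        - 2 * (log r + log⁺ (r⁻¹ * ‖a‖)) := by
    have : smoothedLogDifference s a = (fun z : ℂ ↦ log (‖z - a‖ ^ 2 + s ^ 2))
      - (2 : ℝ) • (fun z : ℂ ↦ log ‖z - a‖) := rfl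
    rw [this, circleAverage_sub hC (hI1.const_smul (a := (2 : ℝ))), circleAverage_smul,
      circleAverage_log_norm_sub_const_eq_log_radius_add_posLog hr.ne']
    simp
  rw [h2]
  linarith

/-- It amounts to ‖u + c‖ ‖u‖ ≤ ‖u‖² + ‖c‖ ‖u‖ ≤ ‖u‖² + s². When u or u + c vanishes, log 0 = 0
breaks this product form, and ‖c‖ ≤ s² is used instead. -/
lemma log_norm_add_sub_log_norm_le {s : ℝ} {u c : ℂ} (hc : c ≠ 0) (hs : ‖c‖ * ‖u‖ ≤ s ^ 2)
    (hs₁ : ‖c‖ ≤ s ^ 2) :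
    log ‖u + c‖ - log ‖u‖ ≤ log (‖u‖ ^ 2 + s ^ 2) - 2 * log ‖u‖ := by
  have hc' : 0 < ‖c‖ := norm_pos_iff.2 hc
  suffices log ‖u + c‖ + log ‖u‖ ≤ log (‖u‖ ^ 2 + s ^ 2) by linarith
  by_cases hu : u = 0
  · simp only [hu, zero_add, norm_zero, log_zero, add_zero]
    exact log_le_log hc' (by nlinarith)
  by_cases huc : u + c = 0
  · have : ‖u‖ = ‖c‖ := by rw [eq_neg_of_add_eq_zero_left huc, norm_neg]
    rw [huc, norm_zero, log_zero, zero_add, this]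
    exact log_le_log hc' (by nlinarith)
  rw [← log_mul (by simpa using huc) (by simpa using hu)]
  have h1 : 0 < ‖u + c‖ := norm_pos_iff.2 huc
  have h2 : 0 < ‖u‖ := norm_pos_iff.2 hu
  exact log_le_log (by positivity) (by nlinarith [norm_add_le u c])

lemma smoothedLogDifference_nonneg {s : ℝ} (hs : 1 ≤ s ^ 2) (a z : ℂ) :
    0 ≤ smoothedLogDifference s a z := by
  unfold smoothedLogDifference
  rcases (norm_nonneg (z - a)).eq_or_lt with h | h
  · rw [← h]
    simpa using log_nonneg hs
  · have := log_le_log (by positivity) (show ‖z - a‖ ^ 2 ≤ ‖z - a‖ ^ 2 + s ^ 2 by linarith)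
    rw [log_pow] at this
    push_cast at this
    linarith

/-- The lower bound is the upper bound for the reverse shift, from z + c - a by -c; this is why a
kernel centred at a - c appears. -/
lemma abs_log_norm_add_sub_log_norm_le {s : ℝ} {a c z : ℂ} (hc : c ≠ 0)
    (hs : ‖c‖ * ‖z - a‖ ≤ s ^ 2) (hs' : ‖c‖ * ‖z + c - a‖ ≤ s ^ 2)
    (hs₁ : ‖c‖ ≤ s ^ 2) (hs₂ : 1 ≤ s ^ 2) :
    |log ‖z + c - a‖ - log ‖z - a‖|
      ≤ smoothedLogDifference s a z + smoothedLogDifference s (a - c) z := by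
  have h1 := smoothedLogDifference_nonneg hs₂ a z
  have h2 := smoothedLogDifference_nonneg hs₂ (a - c) z
  have e1 : z + c - a = (z - a) + c := by ring
  have e2 : z - a = (z + c - a) + (-c) := by ring
  have e3 : z - (a - c) = z + c - a := by ring
  have h3 := log_norm_add_sub_log_norm_le hc hs hs₁
  have h4 := log_norm_add_sub_log_norm_le (u := z + c - a) (neg_ne_zero.2 hc)
    (by simpa using hs') (by simpa using hs₁)
  rw [← e1] at h3
  rw [← e2] at h4
  unfold smoothedLogDifference at *
  rw [e3] at h2 ⊢
  rw [abs_le]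
  constructor <;> linarith

/-- If x ≤ M and M ≥ 0, then |x| ≤ 2M - x; here M = log (2R), and the mean of log ‖z - a‖ is log R.
-/
lemma circleAverage_abs_log_norm_sub_le {R : ℝ} (hR : 1 ≤ R) {a : ℂ} (ha : ‖a‖ ≤ R) :
    circleAverage (fun z ↦ |log ‖z - a‖|) 0 R ≤ 2 * log (2 * R) := by
  have hI := circleIntegrable_log_norm_sub a 0 R
  have hR0 : 0 < R := by linarith
  have hlogR : 0 ≤ log R := log_nonneg hR
  have hlog2R : 0 ≤ log (2 * R) := log_nonneg (by linarith)
  have hpt : ∀ z ∈ sphere (0 : ℂ) |R|, |log ‖z - a‖| ≤ 2 * log (2 * R) - log ‖z - a‖ := by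
    intro z hz
    have hz' : ‖z‖ = R := by simpa [abs_of_pos hR0] using hz
    have h1 : log ‖z - a‖ ≤ log (2 * R) := by
      rcases (norm_nonneg (z - a)).eq_or_lt with h | h
      · rw [← h, log_zero]; exact hlog2R
      · exact log_le_log h (by linarith [norm_sub_le z a])
    rcases abs_cases (log ‖z - a‖) with h | h <;> linarith
  calc _ ≤ circleAverage (fun z ↦ 2 * log (2 * R) - log ‖z - a‖) 0 R :=
        circleAverage_mono hI.abs ((circleIntegrable_const _ 0 R).sub hI) hpt
    _ = 2 * log (2 * R) - log R := by
        rw [circleAverage_fun_sub (circleIntegrable_const _ 0 R) hI, circleAverage_const,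
          circleAverage_log_norm_sub_const_of_mem_closedBall (by simpa [abs_of_pos hR0] using ha)]
    _ ≤ _ := by linarith

end LogarithmicKernel

/-! ### Comparison of circle averages and a Harnack estimate from the Herglotz–Riesz kernel. -/

section CircleAverage

open Real Metric Set

/-- Monotonicity of circle averages, for inequalities that hold away from a discrete set. -/
lemma circleAverage_mono_codiscreteWithin {f g : ℂ → ℝ} {c : ℂ} {r : ℝ} (hr : r ≠ 0)
    (hf : CircleIntegrable f c r) (hg : CircleIntegrable g c r)
    (h : f ≤ᶠ[codiscreteWithin (sphere c |r|)] g) :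
    circleAverage f c r ≤ circleAverage g c r := by
  -- The minimum has the same average as f and lies below g everywhere, so the pointwise
  -- monotonicity lemma applies.
  have h1 : f =ᶠ[codiscreteWithin (sphere c |r|)] fun z ↦ min (f z) (g z) := by
    filter_upwards [h] with z hz using (min_eq_left hz).symm
  rw [circleAverage_congr_codiscreteWithin h1 hr]
  exact circleAverage_mono (hf.congr_codiscreteWithin h1) hg (fun z _ ↦ min_le_right _ _)

lemma norm_herglotzRieszKernel_sub_le {R : ℝ} {w w' z : ℂ} (hz : ‖z‖ = R) (hw : ‖w‖ < R)
    (hw' : ‖w'‖ < R) :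
    ‖herglotzRieszKernel 0 w z - herglotzRieszKernel 0 w' z‖
      ≤ 2 * R * ‖w - w'‖ / ((R - ‖w‖) * (R - ‖w'‖)) := by
  have h1 : R - ‖w‖ ≤ ‖z - w‖ := by rw [← hz]; exact norm_sub_norm_le z w
  have h2 : R - ‖w'‖ ≤ ‖z - w'‖ := by rw [← hz]; exact norm_sub_norm_le z w'
  have h3 : z - w ≠ 0 := norm_pos_iff.1 (by linarith)
  have h4 : z - w' ≠ 0 := norm_pos_iff.1 (by linarith)
  have e : herglotzRieszKernel 0 w z - herglotzRieszKernel 0 w' z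
      = 2 * z * (w - w') / ((z - w) * (z - w')) := by
    simp only [herglotzRieszKernel_def, sub_zero]
    field_simp
    ring
  rw [e, norm_div, norm_mul, norm_mul, norm_mul, hz, Complex.norm_ofNat]
  have : 0 < R - ‖w‖ := by linarith
  have : 0 < R - ‖w'‖ := by linarith
  have : 0 ≤ R := (norm_nonneg z).trans hz.le
  gcongr

/-- A Harnack type inequality for differences of values of a harmonic function. -/
lemma abs_harmonic_sub_le {H : ℂ → ℝ} {R : ℝ}
    (hH : InnerProductSpace.HarmonicOnNhd H (closedBall 0 R)) {w w' : ℂ} (hw : ‖w‖ < R)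
    (hw' : ‖w'‖ < R) :
    |H w - H w'| ≤ 2 * R * ‖w - w'‖ / ((R - ‖w‖) * (R - ‖w'‖))
      * circleAverage (fun z ↦ |H z|) 0 R := by
  have hR : 0 < R := (norm_nonneg w).trans_lt hw
  have hwb : w ∈ ball (0 : ℂ) R := by simpa using hw
  have hwb' : w' ∈ ball (0 : ℂ) R := by simpa using hw'
  have hcont : ContinuousOn H (sphere 0 |R|) := by
    rw [abs_of_pos hR]
    exact hH.continuousOn.mono sphere_subset_closedBall
  have hI (v : ℂ) (hv : v ∈ ball (0 : ℂ) R) :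
      CircleIntegrable ((Complex.re ∘ herglotzRieszKernel 0 v) • H) 0 R := by
    apply ContinuousOn.circleIntegrable'
    exact (Complex.continuous_re.comp_continuousOn
      (continuousOn_herglotzRieszKernel_sphere hv)).smul hcont
  rw [← hH.circleAverage_re_herglotzRieszKernel_smul hwb,
    ← hH.circleAverage_re_herglotzRieszKernel_smul hwb',
    ← circleAverage_sub (hI w hwb) (hI w' hwb')]
  refine abs_circleAverage_le_circleAverage_abs.trans ?_
  rw [← smul_eq_mul, ← circleAverage_fun_smul]
  apply circleAverage_mono ((hI w hwb).sub (hI w' hwb')).abs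
  · exact (CircleIntegrable.abs hcont.circleIntegrable').const_smul
  · intro z hz
    have hz' : ‖z‖ = R := by simpa [abs_of_pos hR] using hz
    change |(herglotzRieszKernel 0 w z).re * H z - (herglotzRieszKernel 0 w' z).re * H z|
      ≤ _ * |H z|
    rw [← sub_mul, abs_mul, ← Complex.sub_re]
    gcongr
    exact (Complex.abs_re_le_norm _).trans (norm_herglotzRieszKernel_sub_le hz' hw hw')

end CircleAverage

/-! ### Logarithmic counting functions as weighted sums, and their behaviour under translation. -/

namespace Function.locallyFinsuppWithin

open Real Metric Set

/-- The weight of a point `z` in the logarithmic counting function for the radius `r`. -/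
noncomputable def logWeight (r : ℝ) (z : ℂ) : ℝ := if ‖z‖ ≤ r then log r - log ‖z‖ else 0

lemma logWeight_nonneg {r : ℝ} (hr : 1 ≤ r) (z : ℂ) : 0 ≤ logWeight r z := by
  unfold logWeight
  split_ifs with h
  · rcases (norm_nonneg z).eq_or_lt with h' | h'
    · rw [← h', log_zero, sub_zero]; exact log_nonneg hr
    · exact sub_nonneg.2 (log_le_log h' h)
  · exact le_rfl

/-- For r ≥ 1 the weight is max (log r - log ‖z‖) 0, a 1-Lipschitz function of log ‖z‖. The
convention log 0 = 0 gives the origin its correct weight log r. -/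
lemma logWeight_le_add {r : ℝ} (hr : 1 ≤ r) (z w : ℂ) :
    logWeight r w ≤ logWeight r z + |log ‖z‖ - log ‖w‖| := by
  have hz := logWeight_nonneg hr z
  have habs := abs_nonneg (log ‖z‖ - log ‖w‖)
  have hle := le_abs_self (log ‖z‖ - log ‖w‖)
  unfold logWeight at *
  by_cases hw : ‖w‖ ≤ r
  · by_cases hz' : ‖z‖ ≤ r
    · simp only [hw, hz', if_true]; linarith
    · have : log r ≤ log ‖z‖ := log_le_log (by linarith) (le_of_not_ge hz')
      simp only [hw, hz', if_true, if_false]; linarith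
  · simp only [hw, if_false]; linarith

/-- The points of the support of `D` in the closed disc of radius `r`. -/
noncomputable def ballSupport (D : locallyFinsupp ℂ ℤ) (r : ℝ) : Finset ℂ :=
  ((toClosedBall r D).finiteSupport (isCompact_closedBall 0 |r|)).toFinset

lemma mem_ballSupport {D : locallyFinsupp ℂ ℤ} {r : ℝ} (hr : 0 ≤ r) {z : ℂ} :
    z ∈ ballSupport D r ↔ D z ≠ 0 ∧ ‖z‖ ≤ r := by
  rw [ballSupport, Set.Finite.mem_toFinset, Function.mem_support]
  by_cases hz : z ∈ closedBall (0 : ℂ) |r|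
  · rw [toClosedBall_eval_within D hz]
    have : ‖z‖ ≤ r := by simpa [abs_of_nonneg hr] using hz
    simp [this]
  · rw [apply_eq_zero_of_notMem _ hz]
    have : ¬ ‖z‖ ≤ r := by simpa [abs_of_nonneg hr] using hz
    simp [this]

/-- Enlarging S is harmless, since outside `ballSupport` either the multiplicity or the weight
vanishes. This lets a divisor and its translate be summed over one index set. -/
lemma logCounting_eq_sum (D : locallyFinsupp ℂ ℤ) {r : ℝ} (hr : 0 < r) {S : Finset ℂ}
    (hS : ballSupport D r ⊆ S) :
    logCounting D r = ∑ z ∈ S, D z * logWeight r z := by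
  have hfin : (toClosedBall r D : ℂ → ℤ).HasFiniteSupport :=
    (toClosedBall r D).finiteSupport (isCompact_closedBall 0 |r|)
  have h0 : (toClosedBall r D) 0 = D 0 := toClosedBall_eval_within D (by simp)
  have h1 : logCounting D r
      = ∑ᶠ u, (toClosedBall r D u : ℝ) * (log r - log ‖(0 : ℂ) - u‖) := by
    rw [countingFunction_finsum_eq_finsum_add hr.ne' hfin]
    simp [logCounting, h0]
  rw [h1, finsum_eq_sum_of_support_subset (s := S)]
  · refine Finset.sum_congr rfl fun z _ ↦ ?_
    by_cases hz : ‖z‖ ≤ r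
    · rw [toClosedBall_eval_within D (by simpa [abs_of_pos hr] using hz)]
      simp [logWeight, hz]
    · rw [apply_eq_zero_of_notMem _ (by simpa [abs_of_pos hr] using hz)]
      simp [logWeight, hz]
  · intro z hz
    apply hS
    rw [ballSupport, Set.Finite.mem_toFinset, Function.mem_support]
    intro h
    simp [h] at hz

lemma sum_mul_logWeight_le (D : locallyFinsupp ℂ ℤ) (hD : 0 ≤ D) {r : ℝ} (hr : 1 ≤ r)
    (S : Finset ℂ) : ∑ z ∈ S, D z * logWeight r z ≤ logCounting D r := by
  classical
  rw [logCounting_eq_sum D (by linarith) (S := S ∪ ballSupport D r) Finset.subset_union_right]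
  refine Finset.sum_le_sum_of_subset_of_nonneg Finset.subset_union_left fun z _ _ ↦ ?_
  exact mul_nonneg (by exact_mod_cast hD z) (logWeight_nonneg hr z)

/-- The unweighted counting function is controlled by the logarithmic counting function for a
larger radius. -/
lemma sum_ite_mul_log_sub_log_le (D : locallyFinsupp ℂ ℤ) (hD : 0 ≤ D) {ρ r : ℝ} (hρ : 1 ≤ ρ)
    (hr : ρ ≤ r) (S : Finset ℂ) :
    (∑ z ∈ S, D z * (if ‖z‖ ≤ ρ then (1 : ℝ) else 0)) * (log r - log ρ) ≤ logCounting D r := by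
  refine le_trans ?_ (sum_mul_logWeight_le D hD (hρ.trans hr) S)
  rw [Finset.sum_mul]
  refine Finset.sum_le_sum fun z _ ↦ ?_
  have hDz : (0 : ℝ) ≤ D z := by exact_mod_cast hD z
  rw [mul_assoc]
  refine mul_le_mul_of_nonneg_left ?_ hDz
  split_ifs with h
  · rw [logWeight, if_pos (h.trans hr), one_mul]
    rcases (norm_nonneg z).eq_or_lt with h' | h'
    · rw [← h', log_zero]; linarith [log_nonneg hρ]
    · linarith [log_le_log h' h]
  · rw [zero_mul]; exact logWeight_nonneg (hρ.trans hr) z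

/-- The translateAdd `z ↦ D (z + c)` of a function with locally finite support. -/
noncomputable def translateAdd (c : ℂ) (D : locallyFinsupp ℂ ℤ) : locallyFinsupp ℂ ℤ where
  toFun z := D (z + c)
  supportWithinDomain' := by simp
  supportLocallyFiniteWithinDomain' := by
    intro z _
    obtain ⟨t, ht, hfin⟩ := D.supportLocallyFiniteWithinDomain' (z + c) (mem_univ _)
    refine ⟨(· + c) ⁻¹' t, (continuous_add_const c).continuousAt.preimage_mem_nhds ht, ?_⟩
    exact (hfin.preimage (add_left_injective c).injOn).subset fun x hx ↦ hx

@[simp]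
lemma translateAdd_apply (c : ℂ) (D : locallyFinsupp ℂ ℤ) (z : ℂ) :
    translateAdd c D z = D (z + c) :=
  rfl

lemma abs_log_norm_sub_le {c z : ℂ} (hz : 2 * ‖c‖ < ‖z‖) :
    |log ‖z‖ - log ‖z - c‖| ≤ 2 * ‖c‖ / ‖z‖ := by
  have hc := norm_nonneg c
  have hz0 : 0 < ‖z‖ := by linarith
  have h1 : ‖z‖ / 2 ≤ ‖z - c‖ := by linarith [norm_sub_norm_le z c]
  have h2 : 0 < ‖z - c‖ := by linarith
  have key {x y : ℝ} (hx : 0 < x) (hy : 0 < y) (hy' : ‖z‖ / 2 ≤ y) (hxy : x - y ≤ ‖c‖) :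
      log x - log y ≤ 2 * ‖c‖ / ‖z‖ := by
    calc log x - log y = log (x / y) := (log_div hx.ne' hy.ne').symm
      _ ≤ x / y - 1 := log_le_sub_one_of_pos (by positivity)
      _ = (x - y) / y := by field_simp
      _ ≤ ‖c‖ / y := by gcongr
      _ ≤ ‖c‖ / (‖z‖ / 2) := by gcongr
      _ = _ := by field_simp
  rw [abs_le]
  constructor
  · have := key h2 hz0 (by linarith) (by linarith [norm_sub_le z c])
    linarith
  · exact key hz0 h2 h1 (by linarith [norm_sub_norm_le z c])

/-- Translations do not change the logarithmic counting function much. -/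
theorem exists_logCounting_translateAdd_le (c : ℂ) (D : locallyFinsupp ℂ ℤ) (hD : 0 ≤ D) :
    ∃ C : ℝ, ∀ᶠ r in atTop, logCounting (translateAdd c D) r ≤ logCounting D r + C
      + logCounting D r * (2 / log r) + logCounting D (4 * r) * (2 * ‖c‖ / √r / log 2) := by
  classical
  have hc := norm_nonneg c
  set M : ℝ := 2 * ‖c‖ + 1
  have hDz (z : ℂ) : (0 : ℝ) ≤ D z := by exact_mod_cast hD z
  set B : ℂ → ℝ := fun z ↦ |log ‖z‖ - log ‖z - c‖|
  refine ⟨∑ z ∈ ballSupport D M, D z * B z, ?_⟩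
  filter_upwards [eventually_ge_atTop (max (‖c‖ + 1) 2)] with r hr
  have hr1 : ‖c‖ + 1 ≤ r := (le_max_left _ _).trans hr
  have hr2 : 2 ≤ r := (le_max_right _ _).trans hr
  have hr0 : 0 < r := by linarith
  have hsqrt : 1 ≤ √r := one_le_sqrt.2 (by linarith)
  have hsqrt' : √r ≤ r := by nlinarith [sq_sqrt hr0.le]
  set S := ballSupport D (r + ‖c‖)
  have hSr : ballSupport D r ⊆ S := fun z hz ↦ by
    rw [mem_ballSupport hr0.le] at hz
    exact (mem_ballSupport (by linarith)).2 ⟨hz.1, by linarith [hz.2]⟩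
  have e1 : logCounting (translateAdd c D) r = ∑ z ∈ S, D z * logWeight r (z - c) := by
    rw [logCounting_eq_sum (translateAdd c D) hr0 (S := S.image (· - c)),
      Finset.sum_image (fun x _ y _ h ↦ sub_left_injective h)]
    · simp
    · intro z hz
      rw [mem_ballSupport hr0.le, translateAdd_apply] at hz
      refine Finset.mem_image.2 ⟨z + c, ?_, by simp⟩
      exact (mem_ballSupport (by linarith)).2 ⟨hz.1, by linarith [norm_add_le z c, hz.2]⟩
  -- Three ranges of ‖z‖: up to M the total change is a constant. Between M and √r each weight
  -- changes by at most 1, and there are at most N(r) · 2 / log r such points. Beyond √r the change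
  -- is at most 2‖c‖ / √r, for at most N(4r) / log 2 points.
  have hterm : ∀ z ∈ S, D z * logWeight r (z - c) ≤ D z * logWeight r z
      + D z * (if ‖z‖ ≤ M then B z else 0) + D z * (if ‖z‖ ≤ √r then (1 : ℝ) else 0)
      + D z * (if ‖z‖ ≤ 2 * r then (1 : ℝ) else 0) * (2 * ‖c‖ / √r) := by
    intro z hz
    have hzn : ‖z‖ ≤ 2 * r := by linarith [((mem_ballSupport (by linarith)).1 hz).2]
    rw [if_pos hzn, mul_one, ← mul_add, ← mul_add, ← mul_add]
    refine mul_le_mul_of_nonneg_left ?_ (hDz z)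
    have h1 := logWeight_le_add (by linarith : 1 ≤ r) z (z - c)
    have h2 : 0 ≤ 2 * ‖c‖ / √r := by positivity
    by_cases hM : ‖z‖ ≤ M
    · have : (0 : ℝ) ≤ (if ‖z‖ ≤ √r then (1 : ℝ) else 0) := by split_ifs <;> norm_num
      rw [if_pos hM]
      simp only [B]
      linarith
    · rw [if_neg hM]
      push Not at hM
      have h3 := abs_log_norm_sub_le (c := c) (z := z) (by linarith)
      by_cases hs : ‖z‖ ≤ √r
      · rw [if_pos hs]
        have : 2 * ‖c‖ / ‖z‖ ≤ 1 := (div_le_one (by linarith)).2 (by linarith)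
        linarith
      · rw [if_neg hs]
        push Not at hs
        have : 2 * ‖c‖ / ‖z‖ ≤ 2 * ‖c‖ / √r := by gcongr
        linarith
  have hsum := Finset.sum_le_sum hterm
  rw [← e1, Finset.sum_add_distrib, Finset.sum_add_distrib, Finset.sum_add_distrib,
    ← logCounting_eq_sum D hr0 hSr, ← Finset.sum_mul] at hsum
  have hB : ∑ z ∈ S, D z * (if ‖z‖ ≤ M then B z else 0) ≤ ∑ z ∈ ballSupport D M, D z * B z := by
    simp_rw [mul_ite, mul_zero]
    rw [← Finset.sum_filter]
    refine Finset.sum_le_sum_of_subset_of_nonneg (fun z hz ↦ ?_)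
      fun z _ _ ↦ mul_nonneg (hDz z) (abs_nonneg _)
    rw [Finset.mem_filter] at hz
    exact (mem_ballSupport (by positivity)).2
      ⟨((mem_ballSupport (by linarith)).1 hz.1).1, hz.2⟩
  have hlogr : 0 < log r := log_pos (by linarith)
  have hs1 := sum_ite_mul_log_sub_log_le D hD hsqrt hsqrt' S
  rw [log_sqrt hr0.le] at hs1
  have hs1' : ∑ z ∈ S, D z * (if ‖z‖ ≤ √r then (1 : ℝ) else 0) ≤ logCounting D r * (2 / log r) := by
    rw [mul_div_assoc', le_div_iff₀ hlogr]
    linarith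
  have hs2 := sum_ite_mul_log_sub_log_le D hD (by linarith : 1 ≤ 2 * r)
    (by linarith : 2 * r ≤ 4 * r) S
  have e4 : log (4 * r) - log (2 * r) = log 2 := by
    rw [← log_div (by positivity) (by positivity)]
    congr 1
    field_simp
    norm_num
  rw [e4] at hs2
  have hlog2 : 0 < log 2 := log_pos (by norm_num)
  have hs2' : (∑ z ∈ S, D z * (if ‖z‖ ≤ 2 * r then (1 : ℝ) else 0)) * (2 * ‖c‖ / √r)
      ≤ logCounting D (4 * r) * (2 * ‖c‖ / √r / log 2) := by
    rw [← le_div_iff₀ hlog2] at hs2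
    calc _ ≤ logCounting D (4 * r) / log 2 * (2 * ‖c‖ / √r) := by gcongr
      _ = _ := by ring
  linarith

end Function.locallyFinsuppWithin

/-! ### The proximity function of a difference quotient. -/

section DifferenceQuotient

open Real Metric Set Topology MeromorphicOn ValueDistribution Function.locallyFinsuppWithin

lemma posLog_norm_div_le (x y : ℂ) : log⁺ ‖x / y‖ ≤ |log ‖x‖ - log ‖y‖| := by
  by_cases hx : x = 0
  · simp [hx, posLog]
  by_cases hy : y = 0
  · simp [hy, posLog]
  rw [norm_div, posLog, log_div (by simpa) (by simpa)]
  exact max_le (abs_nonneg _) (le_abs_self _)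

lemma abs_log_eq_posLog_add_posLog_inv (x : ℝ) : |log x| = log⁺ x + log⁺ x⁻¹ := by
  rw [posLog, posLog, log_inv]
  rcases le_total 0 (log x) with h | h
  · rw [abs_of_nonneg h, max_eq_right h, max_eq_left (by linarith), add_zero]
  · rw [abs_of_nonpos h, max_eq_left h, max_eq_right (by linarith), zero_add]

lemma circleAverage_abs_log_norm_eq {g : ℂ → ℂ} (hg : Meromorphic g) (R : ℝ) :
    circleAverage (fun z ↦ |log ‖g z‖|) 0 R = proximity g ⊤ R + proximity g⁻¹ ⊤ R := by
  simp_rw [abs_log_eq_posLog_add_posLog_inv, ← norm_inv]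
  rw [proximity_top, proximity_top,
    ← circleAverage_add hg.meromorphicOn.circleIntegrable_posLog_norm
    hg.inv.meromorphicOn.circleIntegrable_posLog_norm]
  rfl

lemma eventually_nhdsNE_of_mem_codiscreteWithin {U S : Set ℂ} (h : S ∈ codiscreteWithin U) {x : ℂ}
    (hx : U ∈ 𝓝 x) : ∀ᶠ y in 𝓝[≠] x, y ∈ S := by
  have h1 := mem_codiscreteWithin.1 h x (mem_of_mem_nhds hx)
  rw [disjoint_principal_right] at h1
  filter_upwards [h1, nhdsWithin_le_nhds hx] with y hy hyU
  by_contra hyS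
  exact hy ⟨hyU, hyS⟩

lemma mem_codiscreteWithin_of_eventually_nhdsNE {U S : Set ℂ}
    (h : ∀ x ∈ U, ∀ᶠ y in 𝓝[≠] x, y ∈ S) : S ∈ codiscreteWithin U := by
  rw [mem_codiscreteWithin]
  intro x hx
  rw [disjoint_principal_right]
  filter_upwards [h x hx] with y hy using fun hyU ↦ hyU.2 hy

lemma tendsto_add_const_nhdsNE (x c : ℂ) : Tendsto (· + c) (𝓝[≠] x) (𝓝[≠] (x + c)) := by
  refine tendsto_nhdsWithin_iff.2 ⟨((continuous_add_const c).tendsto x).mono_left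
    nhdsWithin_le_nhds, ?_⟩
  filter_upwards [self_mem_nhdsWithin] with y hy
  simpa using hy

lemma Meromorphic.comp_add_const {f : ℂ → ℂ} (hf : Meromorphic f) (c : ℂ) :
    Meromorphic (fun z ↦ f (z + c)) := fun z ↦
  (hf (z + c)).comp_analyticAt (g := (· + c)) (by fun_prop)

/-- An estimate for the proximity function of a difference quotient, in terms of the proximity
functions for a larger radius and the number of zeros and poles. -/
lemma proximity_div_le {g : ℂ → ℂ} (hg : Meromorphic g) (hg' : ∀ z, meromorphicOrderAt g z ≠ ⊤)
    {c : ℂ} (hc : c ≠ 0) {r : ℝ} (hr : 1 ≤ r) (hrc : 2 * ‖c‖ ≤ r) (hrc' : 1 ≤ 5 * r * ‖c‖) :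
    proximity (fun z ↦ g (z + c) / g z) ⊤ r ≤
      8 * ‖c‖ / r * (proximity g ⊤ (2 * r) + proximity g⁻¹ ⊤ (2 * r)
        + (∑ a ∈ ballSupport (divisor g univ) (2 * r), |(divisor g univ a : ℝ)|)
          * (2 * log (4 * r)))
      + (∑ a ∈ ballSupport (divisor g univ) (2 * r), |(divisor g univ a : ℝ)|)
          * (2 * (√(5 * r * ‖c‖) / r)) := by
  set S := ballSupport (divisor g univ) (2 * r)
  set n : ℝ := ∑ a ∈ S, |(divisor g univ a : ℝ)|
  have hcpos : 0 < ‖c‖ := norm_pos_iff.2 hc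
  set U : Set ℂ := closedBall 0 |2 * r|
  have hR : (0 : ℝ) ≤ 2 * r := by linarith
  have hU : U = closedBall 0 (2 * r) := by simp only [U, abs_of_nonneg hR]
  have hfin := (divisor g U).finiteSupport (isCompact_closedBall 0 |2 * r|)
  -- On the disc of radius 2r, log ‖g‖ splits into the logarithmic kernels of the zeros and poles
  -- and the harmonic function log ‖h‖. The two parts are estimated separately.
  obtain ⟨h, h_an, h_ne, h_eq⟩ := (hg.meromorphicOn (s := U)).extract_zeros_poles
    (fun u ↦ hg' u) hfin
  have hlog := MeromorphicOn.extract_zeros_poles_log h_ne h_eq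
  set D := divisor g U
  have hDS : ∀ a ∈ S, |(D a : ℝ)| = |(divisor g univ a : ℝ)| ∧ ‖a‖ ≤ 2 * r := by
    intro a ha
    have ha' := (mem_ballSupport hR).1 ha
    refine ⟨?_, ha'.2⟩
    simp only [D, U]
    rw [toClosedBall_divisor hg,
      toClosedBall_eval_within _ (by simpa [abs_of_nonneg hR] using ha'.2)]
  have hsum (z : ℂ) : (∑ᶠ u, (fun x ↦ (D u : ℝ) * log ‖x - u‖)) z
      = ∑ u ∈ S, D u * log ‖z - u‖ := by
    rw [finsum_eq_sum_of_support_subset (s := S), Finset.sum_apply]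
    intro u hu
    have hDu : D u ≠ 0 := by
      intro h0
      apply hu
      ext x
      simp [h0]
    have huU : u ∈ U := by
      by_contra hnot
      exact hDu (apply_eq_zero_of_notMem _ hnot)
    refine Finset.mem_coe.2 ((mem_ballSupport hR).2 ⟨?_, by simpa [hU] using huU⟩)
    simp only [D, U] at hDu
    rwa [toClosedBall_divisor hg, toClosedBall_eval_within _ huU] at hDu
  set H : ℂ → ℝ := fun z ↦ log ‖h z‖
  set P : Set ℂ := {z | log ‖g z‖ = ∑ u ∈ S, D u * log ‖z - u‖ + H z}
  have hP : P ∈ codiscreteWithin U := by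
    filter_upwards [hlog] with z hz
    simp only [P, mem_ofPred_eq]
    rw [hz, Pi.add_apply, hsum]
  have hH : InnerProductSpace.HarmonicOnNhd H (closedBall 0 (2 * r)) := by
    rw [← hU]
    exact fun x hx ↦ (h_an x hx).harmonicAt_log_norm (h_ne ⟨x, hx⟩)
  have hHI : CircleIntegrable H 0 (2 * r) := by
    apply ContinuousOn.circleIntegrable hR
    exact hH.continuousOn.mono sphere_subset_closedBall
  have hlogI := fun a ↦ circleIntegrable_log_norm_sub a 0 (2 * r)
  have hHavg : circleAverage (fun z ↦ |H z|) 0 (2 * r)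
      ≤ proximity g ⊤ (2 * r) + proximity g⁻¹ ⊤ (2 * r) + n * (2 * log (4 * r)) := by
    have hI1 : CircleIntegrable (fun z ↦ |log ‖g z‖|) 0 (2 * r) :=
      CircleIntegrable.abs hg.meromorphicOn.circleIntegrable_log_norm
    have hI2 : ∀ a ∈ S, CircleIntegrable (fun z ↦ |(D a : ℝ)| • |log ‖z - a‖|) 0 (2 * r) :=
      fun a _ ↦ (hlogI a).abs.const_smul
    have hI3 : CircleIntegrable (fun z ↦ ∑ a ∈ S, |(D a : ℝ)| • |log ‖z - a‖|) 0 (2 * r) := by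
      have := CircleIntegrable.sum S hI2
      rwa [show (∑ a ∈ S, fun z ↦ |(D a : ℝ)| • |log ‖z - a‖|)
        = fun z ↦ ∑ a ∈ S, |(D a : ℝ)| • |log ‖z - a‖| by ext z; simp] at this
    calc _ ≤ circleAverage
            (fun z ↦ |log ‖g z‖| + ∑ a ∈ S, |(D a : ℝ)| • |log ‖z - a‖|) 0 (2 * r) := by
          apply circleAverage_mono_codiscreteWithin (by positivity) hHI.abs (hI1.add hI3)
          filter_upwards [codiscreteWithin_mono sphere_subset_closedBall hP] with z hz
          have e : H z = log ‖g z‖ - ∑ u ∈ S, D u * log ‖z - u‖ := by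
            rw [hz]; ring
          change |H z| ≤ |log ‖g z‖| + ∑ a ∈ S, |(D a : ℝ)| • |log ‖z - a‖|
          rw [e]
          refine (abs_sub _ _).trans ?_
          gcongr
          refine (Finset.abs_sum_le_sum_abs _ _).trans_eq ?_
          simp [abs_mul]
      _ = proximity g ⊤ (2 * r) + proximity g⁻¹ ⊤ (2 * r)
          + ∑ a ∈ S, |(D a : ℝ)| * circleAverage (fun z ↦ |log ‖z - a‖|) 0 (2 * r) := by
          rw [circleAverage_fun_add hI1 hI3, circleAverage_abs_log_norm_eq hg,
            circleAverage_fun_sum hI2]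
          simp_rw [circleAverage_fun_smul, smul_eq_mul]
      _ ≤ _ := by
          gcongr
          rw [Finset.sum_mul]
          refine Finset.sum_le_sum fun a ha ↦ ?_
          rw [(hDS a ha).1]
          gcongr
          refine (circleAverage_abs_log_norm_sub_le (by linarith) (hDS a ha).2).trans_eq ?_
          ring_nf
  -- For ‖z‖ = r, ‖a‖ ≤ 2r and ‖c‖ ≤ r / 2, both ‖z - a‖ and ‖z + c - a‖ are below 5r, so s²
  -- dominates the products required by the kernel bound. The resulting average s / r is only of
  -- size r^(-1/2).
  set s : ℝ := √(5 * r * ‖c‖)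
  have hs2 : s ^ 2 = 5 * r * ‖c‖ := sq_sqrt (by positivity)
  have hs : 0 < s := sqrt_pos.2 (by positivity)
  -- The Harnack factor for radius 2r, using 2r - ‖z + c‖ ≥ r / 2.
  set K : ℝ := 8 * ‖c‖ / r * circleAverage (fun z ↦ |H z|) 0 (2 * r)
  set V : ℂ → ℂ → ℝ := fun a z ↦
    |(D a : ℝ)| • (smoothedLogDifference s a z + smoothedLogDifference s (a - c) z)
  have hVI : ∀ a ∈ S, CircleIntegrable (V a) 0 r := fun a _ ↦
    ((circleIntegrable_smoothedLogDifference hs a 0 r).add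
      (circleIntegrable_smoothedLogDifference hs (a - c) 0 r)).const_smul
  have hVI' : CircleIntegrable (fun z ↦ ∑ a ∈ S, V a z) 0 r := by
    have := CircleIntegrable.sum S hVI
    rwa [show (∑ a ∈ S, V a) = fun z ↦ ∑ a ∈ S, V a z by ext z; simp] at this
  have hpoint : ∀ z ∈ sphere (0 : ℂ) |r|, z ∈ P → z + c ∈ P →
      log⁺ ‖g (z + c) / g z‖ ≤ K + ∑ a ∈ S, V a z := by
    intro z hz hz1 hz2
    have hz' : ‖z‖ = r := by simpa [abs_of_nonneg (by linarith : (0 : ℝ) ≤ r)] using hz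
    have hzc : ‖z + c‖ ≤ r + ‖c‖ := (norm_add_le z c).trans (by rw [hz'])
    refine (posLog_norm_div_le _ _).trans ?_
    rw [hz1, hz2]
    have e : ∑ u ∈ S, D u * log ‖z + c - u‖ + H (z + c) - (∑ u ∈ S, D u * log ‖z - u‖ + H z)
        = (H (z + c) - H z) + ∑ u ∈ S, D u * (log ‖z + c - u‖ - log ‖z - u‖) := by
      simp_rw [mul_sub, Finset.sum_sub_distrib]
      ring
    rw [e]
    refine (abs_add_le _ _).trans (add_le_add ?_ ?_)
    · refine (abs_harmonic_sub_le hH (w := z + c) (w' := z) (by linarith) (by linarith)).trans ?_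
      refine mul_le_mul_of_nonneg_right ?_ (circleAverage_nonneg_of_nonneg fun _ _ ↦ abs_nonneg _)
      rw [add_sub_cancel_left, hz']
      have h1 : r / 2 ≤ 2 * r - ‖z + c‖ := by linarith
      calc 2 * (2 * r) * ‖c‖ / ((2 * r - ‖z + c‖) * (2 * r - r))
          ≤ 2 * (2 * r) * ‖c‖ / ((r / 2) * (2 * r - r)) := by
            have : 0 < 2 * r - r := by linarith
            gcongr
        _ = 8 * ‖c‖ / r := by
            have : r ≠ 0 := by linarith
            field_simp
            ring
    · refine (Finset.abs_sum_le_sum_abs _ _).trans (Finset.sum_le_sum fun a ha ↦ ?_)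
      rw [abs_mul]
      simp only [V, smul_eq_mul]
      have ha2 := (hDS a ha).2
      refine mul_le_mul_of_nonneg_left (abs_log_norm_add_sub_log_norm_le hc ?_ ?_ ?_ ?_)
        (abs_nonneg _)
      · rw [hs2, mul_comm (5 * r)]
        gcongr
        linarith [norm_sub_le z a]
      · rw [hs2, mul_comm (5 * r)]
        gcongr
        linarith [norm_sub_le (z + c) a]
      · rw [hs2]
        nlinarith
      · rw [hs2]; exact hrc'
  have hmer : Meromorphic (fun z ↦ g (z + c) / g z) := (hg.comp_add_const c).div hg
  calc proximity (fun z ↦ g (z + c) / g z) ⊤ r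
      ≤ circleAverage (fun z ↦ K + ∑ a ∈ S, V a z) 0 r := by
        rw [proximity_top]
        apply circleAverage_mono_codiscreteWithin (by linarith)
          hmer.meromorphicOn.circleIntegrable_posLog_norm ((circleIntegrable_const K 0 r).add hVI')
        -- The factorisation is needed at z and at z + c; both lie inside the disc of radius 2r, so
        -- the exceptional set stays discrete.
        have hP' : P ∩ (· + c) ⁻¹' P ∈ codiscreteWithin (sphere (0 : ℂ) |r|) := by
          apply mem_codiscreteWithin_of_eventually_nhdsNE
          intro x hx
          have hx' : ‖x‖ = r := by simpa [abs_of_nonneg (by linarith : (0 : ℝ) ≤ r)] using hx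
          have hnhds {y : ℂ} (hy : ‖y‖ < 2 * r) : U ∈ 𝓝 y := by
            rw [hU]
            exact mem_of_superset (isOpen_ball.mem_nhds (by simpa using hy)) ball_subset_closedBall
          filter_upwards [eventually_nhdsNE_of_mem_codiscreteWithin hP
              (hnhds (y := x) (by linarith)),
            (tendsto_add_const_nhdsNE x c).eventually (eventually_nhdsNE_of_mem_codiscreteWithin hP
              (hnhds (y := x + c) (by linarith [norm_add_le x c])))] with y h1 h2 using ⟨h1, h2⟩
        filter_upwards [hP', self_mem_codiscreteWithin _] with z hz hzs
          using hpoint z hzs hz.1 hz.2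
    _ = K + ∑ a ∈ S, |(D a : ℝ)| * (circleAverage (smoothedLogDifference s a) 0 r
          + circleAverage (smoothedLogDifference s (a - c)) 0 r) := by
        rw [circleAverage_fun_add (circleIntegrable_const K 0 r) hVI', circleAverage_const,
          circleAverage_fun_sum hVI]
        congr 1
        refine Finset.sum_congr rfl fun a _ ↦ ?_
        simp only [V]
        rw [circleAverage_fun_smul, circleAverage_fun_add
          (circleIntegrable_smoothedLogDifference hs a 0 r)
          (circleIntegrable_smoothedLogDifference hs (a - c) 0 r), smul_eq_mul]
    _ ≤ K + n * (2 * (s / r)) := by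
        gcongr
        rw [Finset.sum_mul]
        refine Finset.sum_le_sum fun a ha ↦ ?_
        rw [(hDS a ha).1]
        gcongr
        have h1 := circleAverage_smoothedLogDifference_le (by linarith : 0 < r) hs a
        have h2 := circleAverage_smoothedLogDifference_le (by linarith : 0 < r) hs (a - c)
        linarith
    _ ≤ _ := by
        simp only [K]
        gcongr

lemma logCounting_top_le_characteristic (g : ℂ → ℂ) (r : ℝ) :
    logCounting g ⊤ r ≤ characteristic g ⊤ r :=
  le_add_of_nonneg_left (proximity_nonneg r)

lemma proximity_top_le_characteristic (g : ℂ → ℂ) {r : ℝ} (hr : 1 ≤ r) :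
    proximity g ⊤ r ≤ characteristic g ⊤ r :=
  le_add_of_nonneg_right (logCounting_nonneg hr)

/-- Each zero or pole in the disc of radius 2r has weight at least log 2 at radius 4r. Zeros are
charged to the characteristic of g⁻¹, poles to that of g. -/
lemma sum_abs_divisor_mul_log_two_le (g : ℂ → ℂ) {r : ℝ} (hr : 1 ≤ r) (S : Finset ℂ)
    (hS : ∀ a ∈ S, ‖a‖ ≤ 2 * r) :
    (∑ a ∈ S, |(divisor g univ a : ℝ)|) * log 2
      ≤ characteristic g ⊤ (4 * r) + characteristic g⁻¹ ⊤ (4 * r) := by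
  have e4 : log (4 * r) - log (2 * r) = log 2 := by
    rw [← log_div (by positivity) (by positivity)]
    congr 1
    field_simp
    norm_num
  have h1 := sum_ite_mul_log_sub_log_le (divisor g univ)⁺ (posPart_nonneg _)
    (by linarith : 1 ≤ 2 * r) (by linarith : 2 * r ≤ 4 * r) S
  have h2 := sum_ite_mul_log_sub_log_le (divisor g univ)⁻ (negPart_nonneg _)
    (by linarith : 1 ≤ 2 * r) (by linarith : 2 * r ≤ 4 * r) S
  rw [e4, ← logCounting_zero, ← logCounting_inv] at h1
  rw [e4, ← logCounting_top] at h2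
  have h3 := logCounting_top_le_characteristic g (4 * r)
  have h4 := logCounting_top_le_characteristic g⁻¹ (4 * r)
  have e : ∑ a ∈ S, |(divisor g univ a : ℝ)|
      = ∑ a ∈ S, ((divisor g univ)⁺ a : ℝ) * (if ‖a‖ ≤ 2 * r then (1 : ℝ) else 0)
        + ∑ a ∈ S, ((divisor g univ)⁻ a : ℝ) * (if ‖a‖ ≤ 2 * r then (1 : ℝ) else 0) := by
    rw [← Finset.sum_add_distrib]
    refine Finset.sum_congr rfl fun a ha ↦ ?_
    rw [if_pos (hS a ha), mul_one, mul_one, posPart_apply, negPart_apply, ← Int.cast_add,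
      posPart_add_negPart, Int.cast_abs]
  rw [e, add_mul]
  linarith

/-- The factor in the estimate of the proximity function of a difference quotient. -/
noncomputable def differenceQuotientFactor (c : ℂ) (r : ℝ) : ℝ :=
  8 * ‖c‖ / r * (1 + 2 * log (4 * r) / log 2) + 2 * (√(5 * r * ‖c‖) / r) / log 2

/-- An analogue of the lemma on the logarithmic derivative, for difference quotients. -/
theorem proximity_div_le_factor_mul {g : ℂ → ℂ} (hg : Meromorphic g)
    (hg' : ∀ z, meromorphicOrderAt g z ≠ ⊤) {c : ℂ} (hc : c ≠ 0) :
    ∀ᶠ r in atTop, proximity (fun z ↦ g (z + c) / g z) ⊤ r ≤ differenceQuotientFactor c r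
      * (characteristic g ⊤ (4 * r) + characteristic g⁻¹ ⊤ (4 * r)) := by
  have hcpos : 0 < ‖c‖ := norm_pos_iff.2 hc
  filter_upwards [eventually_ge_atTop 1, eventually_ge_atTop (2 * ‖c‖),
    eventually_ge_atTop ((5 * ‖c‖)⁻¹)] with r hr hrc hrc'
  have hrc'' : 1 ≤ 5 * r * ‖c‖ := by
    rw [inv_le_iff_one_le_mul₀ (by positivity)] at hrc'
    linarith
  refine (proximity_div_le hg hg' hc hr hrc hrc'').trans ?_
  have hlog2 : 0 < log 2 := log_pos (by norm_num)
  have hlog : 0 ≤ log (4 * r) := log_nonneg (by linarith)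
  have hn := sum_abs_divisor_mul_log_two_le g hr (ballSupport (divisor g univ) (2 * r))
    (fun a ha ↦ ((mem_ballSupport (by linarith)).1 ha).2)
  rw [← le_div_iff₀ hlog2] at hn
  have mono {h : ℂ → ℂ} (hh : Meromorphic h) :
      proximity h ⊤ (2 * r) ≤ characteristic h ⊤ (4 * r) :=
    (proximity_top_le_characteristic h (by linarith)).trans
      (characteristic_monotoneOn hh (by simp; linarith) (by simp; linarith) (by linarith))
  have h1 := mono hg
  have h2 := mono hg.inv
  set n := ∑ a ∈ ballSupport (divisor g univ) (2 * r), |(divisor g univ a : ℝ)|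
  set X := characteristic g ⊤ (4 * r)
  set Y := characteristic g⁻¹ ⊤ (4 * r)
  calc _ ≤ 8 * ‖c‖ / r * (X + Y + (X + Y) / log 2 * (2 * log (4 * r)))
        + (X + Y) / log 2 * (2 * (√(5 * r * ‖c‖) / r)) := by gcongr
    _ = _ := by unfold differenceQuotientFactor; ring

lemma tendsto_differenceQuotientFactor (c : ℂ) :
    Tendsto (differenceQuotientFactor c) atTop (𝓝 0) := by
  have h1 : Tendsto (fun r : ℝ ↦ 8 * ‖c‖ / r) atTop (𝓝 0) := tendsto_const_nhds.div_atTop tendsto_id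
  have h2 : Tendsto (fun r : ℝ ↦ log (4 * r) / (4 * r)) atTop (𝓝 0) := by
    have : Tendsto (fun x : ℝ ↦ log x / x) atTop (𝓝 0) := by
      simpa using isLittleO_log_id_atTop.tendsto_div_nhds_zero
    exact this.comp (tendsto_id.const_mul_atTop (by norm_num : (0 : ℝ) < 4))
  have h3 : Tendsto (fun r : ℝ ↦ √(5 * ‖c‖) / √r) atTop (𝓝 0) :=
    tendsto_const_nhds.div_atTop tendsto_sqrt_atTop
  have h4 := (h1.add (h2.const_mul (64 * ‖c‖ / log 2))).add (h3.const_mul (2 / log 2))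
  simp only [mul_zero, add_zero] at h4
  refine h4.congr' ?_
  filter_upwards [eventually_gt_atTop 0] with r hr
  have e : √(5 * r * ‖c‖) / r = √(5 * ‖c‖) / √r := by
    rw [show 5 * r * ‖c‖ = 5 * ‖c‖ * r by ring, sqrt_mul (by positivity)]
    have := sqrt_pos.2 hr
    rw [div_eq_div_iff hr.ne' this.ne', mul_assoc, mul_self_sqrt hr.le]
  unfold differenceQuotientFactor
  rw [e]
  field_simp
  ring

end DifferenceQuotient

/-! ### Paired points and the divisor of the exact difference. -/

section Divisors

open Real Metric Set Topology MeromorphicOn ValueDistribution Function.locallyFinsuppWithin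

lemma meromorphicOrderAt_comp_add_const (f : ℂ → ℂ) (c z : ℂ) :
    meromorphicOrderAt (fun w ↦ f (w + c)) z = meromorphicOrderAt f (z + c) := by
  have h : HasDerivAt (fun w : ℂ ↦ w + c) 1 z := (hasDerivAt_id z).add_const c
  exact meromorphicOrderAt_comp_of_deriv_ne_zero (f := f) (g := fun w ↦ w + c) (by fun_prop)
    (by rw [h.deriv]; exact one_ne_zero)

lemma divisor_univ_apply {f : ℂ → ℂ} (hf : Meromorphic f) (z : ℂ) :
    divisor f univ z = (meromorphicOrderAt f z).untop₀ :=
  divisor_apply hf.meromorphicOn (mem_univ z)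

/-- The zero divisor of `f - a`. -/
noncomputable def valueDivisor (f : ℂ → ℂ) (a : ℂ) : Function.locallyFinsupp ℂ ℤ :=
  (divisor (fun z ↦ f z - a) univ)⁺

/-- The pole divisor of `f`. -/
noncomputable def poleDivisor (f : ℂ → ℂ) : Function.locallyFinsupp ℂ ℤ := (divisor f univ)⁻

lemma valueDivisor_apply (f : ℂ → ℂ) (a z : ℂ) :
    valueDivisor f a z = max (divisor (fun z ↦ f z - a) univ z) 0 := rfl

lemma poleDivisor_apply (f : ℂ → ℂ) (z : ℂ) : poleDivisor f z = max (-divisor f univ z) 0 := rfl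

lemma valueDivisor_nonneg (f : ℂ → ℂ) (a : ℂ) : 0 ≤ valueDivisor f a := posPart_nonneg _

lemma poleDivisor_nonneg (f : ℂ → ℂ) : 0 ≤ poleDivisor f := negPart_nonneg _

/-- The points `z` for which `z` and `z + c` belong to `D`, counted with the smaller of the two
multiplicities. -/
noncomputable def pairDivisor (c : ℂ) (D : Function.locallyFinsupp ℂ ℤ) :
    Function.locallyFinsupp ℂ ℤ := min D (translateAdd c D)

@[simp]
lemma pairDivisor_apply (c : ℂ) (D : Function.locallyFinsupp ℂ ℤ) (z : ℂ) :
    pairDivisor c D z = min (D z) (D (z + c)) := rfl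

lemma pairDivisor_nonneg (c : ℂ) {D : Function.locallyFinsupp ℂ ℤ} (hD : 0 ≤ D) :
    0 ≤ pairDivisor c D := fun z ↦ le_min (hD z) (hD (z + c))

lemma pairDivisor_le (c : ℂ) (D : Function.locallyFinsupp ℂ ℤ) : pairDivisor c D ≤ D :=
  fun _ ↦ min_le_left _ _

/-- A point z matched with z + c is counted by the first summand; one matched with z - c ends a pair
started there and is counted by the second. -/
lemma le_pairDivisor_add_translate {c : ℂ} {D : Function.locallyFinsupp ℂ ℤ} (hD : 0 ≤ D)
    (h : ∀ z, D z ≠ 0 → D (z + c) = D z ∨ D (z - c) = D z) :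
    D ≤ pairDivisor c D + translateAdd (-c) (pairDivisor c D) := by
  intro z
  have h0 : 0 ≤ D z := hD z
  have h1 : 0 ≤ D (z + c) := hD (z + c)
  have h2 : 0 ≤ D (z - c) := hD (z - c)
  simp only [coe_add, Pi.add_apply, pairDivisor_apply, translateAdd_apply, ← sub_eq_add_neg,
    sub_add_cancel]
  by_cases hz : D z = 0
  · omega
  · rcases h z hz with h | h <;> omega

/-- `f` is meromorphic, and `Δ_c f` does not vanish identically. -/
structure HasNonzeroDifference (c : ℂ) (f : ℂ → ℂ) : Prop where
  meromorphic : Meromorphic f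
  not_eventuallyEq : ¬ exactDifference c f =ᶠ[codiscrete ℂ] 0

variable {c : ℂ} {f : ℂ → ℂ}

lemma eventually_nhdsNE_eq_zero_of_meromorphicOrderAt_eq_top {g : ℂ → ℂ} (hg : Meromorphic g)
    {z : ℂ} (hz : meromorphicOrderAt g z = ⊤) (x : ℂ) : ∀ᶠ y in 𝓝[≠] x, g y = 0 := by
  rw [← meromorphicOrderAt_eq_top_iff]
  by_contra h
  exact hg.exists_meromorphicOrderAt_ne_top_iff_forall.1 ⟨x, h⟩ z hz

namespace HasNonzeroDifference

lemma meromorphic_sub (h : HasNonzeroDifference c f) (a : ℂ) : Meromorphic (fun z ↦ f z - a) :=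
  h.meromorphic.sub (Meromorphic.const a)

lemma meromorphic_difference (h : HasNonzeroDifference c f) : Meromorphic (exactDifference c f) :=
  (h.meromorphic.comp_add_const c).sub h.meromorphic

lemma meromorphicOrderAt_difference_ne_top (h : HasNonzeroDifference c f) (z : ℂ) :
    meromorphicOrderAt (exactDifference c f) z ≠ ⊤ := fun hz ↦
  h.not_eventuallyEq (mem_codiscreteWithin_of_eventually_nhdsNE fun x _ ↦
    eventually_nhdsNE_eq_zero_of_meromorphicOrderAt_eq_top h.meromorphic_difference hz x)

lemma meromorphicOrderAt_sub_ne_top (h : HasNonzeroDifference c f) (a z : ℂ) :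
    meromorphicOrderAt (fun w ↦ f w - a) z ≠ ⊤ := by
  intro hz
  refine h.not_eventuallyEq (mem_codiscreteWithin_of_eventually_nhdsNE fun x _ ↦ ?_)
  have key := eventually_nhdsNE_eq_zero_of_meromorphicOrderAt_eq_top (h.meromorphic_sub a) hz
  filter_upwards [key x, (tendsto_add_const_nhdsNE x c).eventually (key (x + c))] with y h1 h2
  change f (y + c) - f y = 0
  linear_combination h2 - h1

lemma meromorphicOrderAt_ne_top (h : HasNonzeroDifference c f) (z : ℂ) :
    meromorphicOrderAt f z ≠ ⊤ := by
  simpa using h.meromorphicOrderAt_sub_ne_top 0 z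

lemma separation_ne_zero (h : HasNonzeroDifference c f) : c ≠ 0 := by
  rintro rfl
  apply h.not_eventuallyEq
  filter_upwards with z
  simp [exactDifference]

/-- Infinite multiplicity would make f constant and Δ_c f zero, so the multiplicities are those of a
divisor. -/
lemma valueMultiplicity_coe (h : HasNonzeroDifference c f) (a z : ℂ) :
    valueMultiplicity f a z = ((valueDivisor f a z).toNat : ℕ∞) := by
  have h1 : valueMultiplicity f a z
    = WithTop.map Int.toNat (meromorphicOrderAt (fun w ↦ f w - a) z) := rfl
  rw [h1, valueDivisor_apply, divisor_univ_apply (h.meromorphic_sub a)]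
  lift meromorphicOrderAt (fun w ↦ f w - a) z to ℤ using h.meromorphicOrderAt_sub_ne_top a z with n
  have : (max n 0).toNat = n.toNat := by omega
  rw [WithTop.untop₀_coe, this]
  rfl

lemma valueMultiplicity_top (h : HasNonzeroDifference c f) (z : ℂ) :
    valueMultiplicity f ⊤ z = ((poleDivisor f z).toNat : ℕ∞) := by
  have h1 : valueMultiplicity f ⊤ z = ((-(meromorphicOrderAt f z).untop₀).toNat : ℕ∞) := rfl
  rw [h1, poleDivisor_apply, divisor_univ_apply h.meromorphic]
  congr 1
  omega

lemma le_pairDivisor_of_valueMultiplicity {D : Function.locallyFinsupp ℂ ℤ} (hD : 0 ≤ D)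
    {a : WithTop ℂ} (hm : ∀ z, valueMultiplicity f a z = ((D z).toNat : ℕ∞))
    (hp : IsCompletelyPaired f c a) :
    D ≤ pairDivisor c D + translateAdd (-c) (pairDivisor c D) := by
  refine le_pairDivisor_add_translate hD fun z hz ↦ ?_
  have h0 : 0 ≤ D z := hD z
  have h1 : 0 ≤ D (z + c) := hD (z + c)
  have h2 : 0 ≤ D (z - c) := hD (z - c)
  have := hp z (by rw [hm]; norm_cast; omega)
  simp only [hm, Nat.cast_inj] at this
  omega

lemma valueDivisor_le_of_isCompletelyPaired (h : HasNonzeroDifference c f) {a : ℂ}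
    (ha : IsCompletelyPaired f c a) : valueDivisor f a
      ≤ pairDivisor c (valueDivisor f a) + translateAdd (-c) (pairDivisor c (valueDivisor f a)) :=
  le_pairDivisor_of_valueMultiplicity (valueDivisor_nonneg f a) (h.valueMultiplicity_coe a) ha

lemma poleDivisor_le_of_isCompletelyPaired (h : HasNonzeroDifference c f)
    (ha : IsCompletelyPaired f c ⊤) : poleDivisor f
      ≤ pairDivisor c (poleDivisor f) + translateAdd (-c) (pairDivisor c (poleDivisor f)) :=
  le_pairDivisor_of_valueMultiplicity (poleDivisor_nonneg f) h.valueMultiplicity_top ha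

/-- Δ_c f is the difference of f(z + c) - a and f(z) - a. Negative orders are allowed, so the case a
= 0 also controls poles. -/
lemma min_divisor_le_divisor_difference (h : HasNonzeroDifference c f) (a z : ℂ) :
    min (divisor (fun w ↦ f w - a) univ z) (divisor (fun w ↦ f w - a) univ (z + c))
      ≤ divisor (exactDifference c f) univ z := by
  have hm := h.meromorphic_sub a
  have e : exactDifference c f = (fun w ↦ f (w + c) - a) + -(fun w ↦ f w - a) := by
    ext w; simp [exactDifference]
  have h1 := meromorphicOrderAt_add (hm.comp_add_const c z) (hm z).neg
  rw [← e, ← meromorphicOrderAt_neg, meromorphicOrderAt_comp_add_const (fun w ↦ f w - a)] at h1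
  have hΔ := h.meromorphicOrderAt_difference_ne_top z
  rw [divisor_univ_apply hm, divisor_univ_apply hm, divisor_univ_apply h.meromorphic_difference]
  have ha1 := h.meromorphicOrderAt_sub_ne_top a z
  have ha2 := h.meromorphicOrderAt_sub_ne_top a (z + c)
  lift meromorphicOrderAt (exactDifference c f) z to ℤ using hΔ with w
  lift meromorphicOrderAt (fun w ↦ f w - a) z to ℤ using ha1 with x
  lift meromorphicOrderAt (fun w ↦ f w - a) (z + c) to ℤ using ha2 with y
  norm_cast at h1
  simp only [WithTop.untop₀_coe]
  omega

lemma eq_of_valueDivisor_ne_zero (h : HasNonzeroDifference c f) {a b z : ℂ}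
    (ha : valueDivisor f a z ≠ 0) (hb : valueDivisor f b z ≠ 0) : a = b := by
  by_contra hab
  rw [valueDivisor_apply, divisor_univ_apply (h.meromorphic_sub _)] at ha hb
  have ha1 := h.meromorphicOrderAt_sub_ne_top a z
  have hb1 := h.meromorphicOrderAt_sub_ne_top b z
  have e : (fun _ : ℂ ↦ b - a) = (fun w ↦ f w - a) + -(fun w ↦ f w - b) := by
    ext w; simp
  have h1 := meromorphicOrderAt_add (h.meromorphic_sub a z) (h.meromorphic_sub b z).neg
  rw [← e, ← meromorphicOrderAt_neg, meromorphicOrderAt_const,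
    if_neg (sub_ne_zero.2 (Ne.symm hab))] at h1
  lift meromorphicOrderAt (fun w ↦ f w - a) z to ℤ using ha1 with x
  lift meromorphicOrderAt (fun w ↦ f w - b) z to ℤ using hb1 with y
  norm_cast at h1
  simp only [WithTop.untop₀_coe] at ha hb
  omega

/-- At a given z at most one value a contributes, because f cannot take two values there; that
contribution is bounded by the order of vanishing of Δ_c f. -/
lemma sum_pairDivisor_le (h : HasNonzeroDifference c f) (A : Finset ℂ) :
    ∑ a ∈ A, pairDivisor c (valueDivisor f a) ≤ (divisor (exactDifference c f) univ)⁺ := by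
  intro z
  have hnn (a x : ℂ) : 0 ≤ valueDivisor f a x := valueDivisor_nonneg f a x
  rw [coe_sum, Finset.sum_apply]
  by_cases hex : ∃ a ∈ A, pairDivisor c (valueDivisor f a) z ≠ 0
  · obtain ⟨a, ha, haz⟩ := hex
    have hne {b : ℂ} (hb : pairDivisor c (valueDivisor f b) z ≠ 0) : valueDivisor f b z ≠ 0 := by
      have h1 := hnn b z
      have h2 := hnn b (z + c)
      rw [pairDivisor_apply] at hb
      omega
    rw [Finset.sum_eq_single_of_mem a ha]
    · have h1 := h.min_divisor_le_divisor_difference a z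
      rw [pairDivisor_apply] at haz ⊢
      rw [posPart_apply, posPart_def]
      simp only [valueDivisor_apply] at haz ⊢
      omega
    · intro b _ hba
      by_contra hb
      exact hba (h.eq_of_valueDivisor_ne_zero (hne hb) (hne haz))
  · push Not at hex
    rw [Finset.sum_eq_zero hex]
    exact posPart_nonneg (divisor (exactDifference c f) univ z)

/-- If f has poles of orders p and q at z and z + c (0 for no pole), Δ_c f has a pole of order at
most max p q, and max p q + min p q = p + q. -/
lemma negPart_divisor_difference_add_pairDivisor_le (h : HasNonzeroDifference c f) :
    (divisor (exactDifference c f) univ)⁻ + pairDivisor c (poleDivisor f)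
      ≤ poleDivisor f + translateAdd c (poleDivisor f) := by
  intro z
  have h1 : min (divisor f univ z) (divisor f univ (z + c))
      ≤ divisor (exactDifference c f) univ z := by
    simpa only [sub_zero] using h.min_divisor_le_divisor_difference 0 z
  simp only [coe_add, Pi.add_apply, pairDivisor_apply, translateAdd_apply, poleDivisor_apply]
  rw [negPart_apply, negPart_def]
  omega

end HasNonzeroDifference

end Divisors

/-! ### Radii of controlled growth, and inequalities up to o(T). -/

section GoodRadii

open Real Metric Set Topology MeromorphicOn ValueDistribution Function.locallyFinsuppWithin

/-- `F` is at most `G`, up to an error that is small compared to `T` along the filter `l`. -/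
def LeUpTo (l : Filter ℝ) (T F G : ℝ → ℝ) : Prop := ∀ ε > 0, ∀ᶠ r in l, F r ≤ G r + ε * T r

/-- A filter of large radii along which the function `T` tends to infinity, and along which
`T (4 * r)` is bounded by a multiple of `T r`. -/
structure IsGoodRadii (T : ℝ → ℝ) (l : Filter ℝ) : Prop where
  neBot : l.NeBot
  le_atTop : l ≤ atTop
  tendsto : Tendsto T l atTop
  exists_doubling : ∃ K, ∀ᶠ r in l, T (4 * r) ≤ K * T r

lemma IsOfFiniteOrder.exists_le_pow {f : ℂ → ℂ} (hf : IsOfFiniteOrder f) :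
    ∃ N : ℕ, ∀ᶠ r in atTop, characteristic f ⊤ r ≤ r ^ N := by
  obtain ⟨ρ, hρ, -⟩ := EReal.lt_iff_exists_real_btwn.1 hf
  obtain ⟨N, hN⟩ := exists_nat_ge ρ
  refine ⟨N, ?_⟩
  filter_upwards [eventually_lt_of_limsup_lt hρ, eventually_gt_atTop 1] with r hr hr1
  have hlog : 0 < log r := log_pos hr1
  rw [EReal.coe_lt_coe_iff, div_lt_iff₀ hlog] at hr
  rcases le_or_gt (characteristic f ⊤ r) 0 with h | h
  · exact h.trans (by positivity)
  · rw [← log_le_log_iff h (by positivity), log_pow]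
    calc log (characteristic f ⊤ r) ≤ log⁺ (characteristic f ⊤ r) := le_max_right _ _
      _ ≤ ρ * log r := hr.le
      _ ≤ N * log r := by gcongr

/-- If T(4r) > 4^(N+1) T(r) for all large r, iteration gives T(4ⁿ r₀) ≥ 4^(n(N+1)), which exceeds
(4ⁿ r₀)^N once 4ⁿ > r₀^N. So the good radii are unbounded, and `atTop` restricted to them is a
proper filter. -/
lemma exists_isGoodRadii {T : ℝ → ℝ} (hT : Tendsto T atTop atTop) {N : ℕ}
    (hN : ∀ᶠ r in atTop, T r ≤ r ^ N) : ∃ l, IsGoodRadii T l := by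
  set K : ℝ := 4 ^ (N + 1)
  refine ⟨atTop ⊓ 𝓟 {r | T (4 * r) ≤ K * T r}, ?_, inf_le_left, hT.mono_left inf_le_left, K,
    mem_inf_of_right (mem_principal_self _)⟩
  rw [← frequently_mem_iff_neBot]
  intro hnot
  obtain ⟨r₀, hr₀⟩ := eventually_atTop.1 (hnot.and (hN.and ((hT.eventually_ge_atTop 1).and
    (eventually_ge_atTop 1))))
  have h1 : 1 ≤ r₀ := (hr₀ r₀ le_rfl).2.2.2
  have hge (n : ℕ) : r₀ ≤ 4 ^ n * r₀ :=
    le_mul_of_one_le_left (by linarith) (one_le_pow₀ (by norm_num))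
  have hlow (n : ℕ) : K ^ n ≤ T (4 ^ n * r₀) := by
    induction n with
    | zero => simpa using (hr₀ r₀ le_rfl).2.2.1
    | succ n ih =>
      have := (hr₀ _ (hge n)).1
      simp only [mem_ofPred_eq, not_le] at this
      calc K ^ (n + 1) = K * K ^ n := pow_succ' K n
        _ ≤ K * T (4 ^ n * r₀) := by gcongr
        _ ≤ T (4 * (4 ^ n * r₀)) := this.le
        _ = T (4 ^ (n + 1) * r₀) := by ring_nf
  obtain ⟨n, hn⟩ := pow_unbounded_of_one_lt (r₀ ^ N) (by norm_num : (1 : ℝ) < 4)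
  have h2 := (hlow n).trans (hr₀ _ (hge n)).2.1
  have h3 : K ^ n = (4 : ℝ) ^ n * ((4 : ℝ) ^ n) ^ N := by
    simp only [K]
    rw [← pow_mul, ← pow_mul, ← pow_add]
    congr 1
    ring
  rw [h3, mul_pow, mul_comm] at h2
  have h4 := le_of_mul_le_mul_left h2 (by positivity)
  linarith

namespace LeUpTo

variable {l : Filter ℝ} {T F G H F' G' : ℝ → ℝ}

lemma of_le (h : ∀ᶠ r in l, F r ≤ G r) (hT : Tendsto T l atTop) : LeUpTo l T F G := fun ε hε ↦ by
  filter_upwards [h, hT.eventually_ge_atTop 0] with r hr hr'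
  have := mul_nonneg hε.le hr'
  linarith

lemma trans (h : LeUpTo l T F G) (h' : LeUpTo l T G H) : LeUpTo l T F H := fun ε hε ↦ by
  filter_upwards [h (ε / 2) (by positivity), h' (ε / 2) (by positivity)] with r h1 h2
  linarith

lemma add (h : LeUpTo l T F G) (h' : LeUpTo l T F' G') :
    LeUpTo l T (fun r ↦ F r + F' r) (fun r ↦ G r + G' r) := fun ε hε ↦ by
  filter_upwards [h (ε / 2) (by positivity), h' (ε / 2) (by positivity)] with r h1 h2
  linarith

lemma const (C : ℝ) (hT : Tendsto T l atTop) : LeUpTo l T (fun _ ↦ C) 0 := fun ε hε ↦ by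
  filter_upwards [hT.eventually_ge_atTop (C / ε)] with r hr
  rw [div_le_iff₀ hε] at hr
  simp only [Pi.zero_apply]
  linarith

lemma of_le_add_const {C : ℝ} (h : ∀ᶠ r in l, F r ≤ G r + C) (hT : Tendsto T l atTop) :
    LeUpTo l T F G := fun ε hε ↦ by
  filter_upwards [h, const C hT ε hε] with r h1 h2
  simp only [Pi.zero_apply] at h2
  linarith

lemma sum {ι : Type*} {F G : ι → ℝ → ℝ} (s : Finset ι) (hT : Tendsto T l atTop)
    (h : ∀ i ∈ s, LeUpTo l T (F i) (G i)) :
    LeUpTo l T (fun r ↦ ∑ i ∈ s, F i r) (fun r ↦ ∑ i ∈ s, G i r) := by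
  classical
  induction s using Finset.induction with
  | empty => exact of_le (by simp) hT
  | insert a s ha ih =>
    simp_rw [Finset.sum_insert ha]
    exact (h a (Finset.mem_insert_self a s)).add
      (ih fun i hi ↦ h i (Finset.mem_insert_of_mem hi))

lemma mul_of_tendsto_zero {ψ : ℝ → ℝ} {B : ℝ} (hψ : Tendsto ψ l (𝓝 0))
    (hF : ∀ᶠ r in l, 0 ≤ F r) (h : ∀ᶠ r in l, F r ≤ B * T r) (hT : Tendsto T l atTop) :
    LeUpTo l T (fun r ↦ ψ r * F r) 0 := fun ε hε ↦ by
  have hB : 0 < |B| + 1 := by positivity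
  filter_upwards [hF, h, hψ.eventually (gt_mem_nhds (div_pos hε hB)), hT.eventually_ge_atTop 0]
    with r h1 h2 h3 h4
  simp only [Pi.zero_apply, zero_add]
  calc ψ r * F r ≤ ε / (|B| + 1) * F r := by gcongr
    _ ≤ ε / (|B| + 1) * ((|B| + 1) * T r) := by
      gcongr
      refine h2.trans ?_
      gcongr
      linarith [le_abs_self B]
    _ = ε * T r := by field_simp

end LeUpTo

variable {c : ℂ} {f : ℂ → ℂ} {l : Filter ℝ}

lemma exists_characteristic_sub_characteristic_inv_le {g : ℂ → ℂ} (hg : Meromorphic g) :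
    ∃ C, ∀ r, |characteristic g ⊤ r - characteristic g⁻¹ ⊤ r| ≤ C :=
  ⟨_, fun _ ↦ characteristic_sub_characteristic_inv_le hg⟩

lemma logCounting_inv_top_eq_logCounting_valueDivisor (f : ℂ → ℂ) (a : ℂ) :
    logCounting (fun z ↦ f z - a)⁻¹ ⊤
      = Function.locallyFinsuppWithin.logCounting (valueDivisor f a) := by
  rw [logCounting_inv, logCounting_zero, valueDivisor]

namespace HasNonzeroDifference

/-- The first main theorem: shifting by a constant and inverting change the characteristic by a
bounded amount. -/
lemma exists_characteristic_inv_sub_le (h : HasNonzeroDifference c f) (a : ℂ) :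
    ∃ C, ∀ r, |characteristic f ⊤ r - characteristic (fun z ↦ f z - a)⁻¹ ⊤ r| ≤ C ∧
      |characteristic f ⊤ r - characteristic (fun z ↦ f z - a) ⊤ r| ≤ C := by
  obtain ⟨C, hC⟩ := exists_characteristic_sub_characteristic_inv_le (h.meromorphic_sub a)
  have hC0 : 0 ≤ C := (abs_nonneg _).trans (hC 0)
  refine ⟨C + (log⁺ ‖a‖ + log 2), fun r ↦ ?_⟩
  have h1 := abs_characteristic_sub_characteristic_shift_le (a₀ := a) (r := r) h.meromorphic
  refine ⟨?_, by linarith⟩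
  calc _ = |(characteristic f ⊤ r - characteristic (fun z ↦ f z - a) ⊤ r)
        + (characteristic (fun z ↦ f z - a) ⊤ r - characteristic (fun z ↦ f z - a)⁻¹ ⊤ r)| := by
        congr 1; ring
    _ ≤ _ := (abs_add_le _ _).trans (by linarith [hC r])

lemma exists_logCounting_valueDivisor_le (h : HasNonzeroDifference c f) (a : ℂ) :
    ∃ C, ∀ r, Function.locallyFinsuppWithin.logCounting (valueDivisor f a) r
      ≤ characteristic f ⊤ r + C := by
  obtain ⟨C, hC⟩ := h.exists_characteristic_inv_sub_le a
  refine ⟨C, fun r ↦ ?_⟩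
  have h1 := logCounting_top_le_characteristic (fun z ↦ f z - a)⁻¹ r
  rw [logCounting_inv_top_eq_logCounting_valueDivisor] at h1
  linarith [(abs_le.1 (hC r).1).1]

lemma logCounting_poleDivisor_le (f : ℂ → ℂ) (r : ℝ) :
    Function.locallyFinsuppWithin.logCounting (poleDivisor f) r ≤ characteristic f ⊤ r := by
  have h1 := logCounting_top_le_characteristic f r
  rwa [logCounting_top] at h1

lemma log_le_logCounting {D : Function.locallyFinsupp ℂ ℤ} (hD : 0 ≤ D) (h0 : D 0 ≠ 0) {r : ℝ}
    (hr : 1 ≤ r) : log r ≤ Function.locallyFinsuppWithin.logCounting D r := by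
  have h1 := sum_mul_logWeight_le D hD hr {0}
  simp only [Finset.sum_singleton, logWeight, norm_zero, log_zero, sub_zero,
    if_pos (by linarith : (0 : ℝ) ≤ r)] at h1
  have h2 : 1 ≤ D 0 := by have : 0 ≤ D 0 := hD 0; omega
  have h3 : (1 : ℝ) ≤ D 0 := by exact_mod_cast h2
  nlinarith [log_nonneg hr]

/-- At the origin f has a pole or a finite limit a. That single point contributes at least log r to
the counting function of ∞ or of a, and the first main theorem bounds this by T + O(1). -/
lemma tendsto_characteristic (h : HasNonzeroDifference c f) :
    Tendsto (characteristic f ⊤) atTop atTop := by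
  suffices ∃ C, ∀ r ≥ 1, log r + C ≤ characteristic f ⊤ r by
    obtain ⟨C, hC⟩ := this
    refine tendsto_atTop_mono' atTop ?_ (tendsto_atTop_add_const_right atTop C tendsto_log_atTop)
    filter_upwards [eventually_ge_atTop 1] with r hr using hC r hr
  rcases lt_or_ge (meromorphicOrderAt f 0) 0 with h0 | h0
  · refine ⟨0, fun r hr ↦ ?_⟩
    have h1 : poleDivisor f 0 ≠ 0 := by
      rw [poleDivisor_apply, divisor_univ_apply h.meromorphic]
      have hne := h.meromorphicOrderAt_ne_top 0
      lift meromorphicOrderAt f 0 to ℤ using hne with n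
      norm_cast at h0
      rw [WithTop.untop₀_coe]
      omega
    linarith [log_le_logCounting (poleDivisor_nonneg f) h1 hr, logCounting_poleDivisor_le f r]
  · obtain ⟨a, ha⟩ := tendsto_nhds_of_meromorphicOrderAt_nonneg (h.meromorphic 0) h0
    have hlim : Tendsto (fun z ↦ f z - a) (𝓝[≠] 0) (𝓝 0) := by
      simpa using ha.sub_const a
    have hpos := (tendsto_zero_iff_meromorphicOrderAt_pos (h.meromorphic_sub a 0)).1 hlim
    have h1 : valueDivisor f a 0 ≠ 0 := by
      rw [valueDivisor_apply, divisor_univ_apply (h.meromorphic_sub a)]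
      have hne := h.meromorphicOrderAt_sub_ne_top a 0
      lift meromorphicOrderAt (fun z ↦ f z - a) 0 to ℤ using hne with n
      norm_cast at hpos
      rw [WithTop.untop₀_coe]
      omega
    obtain ⟨C, hC⟩ := h.exists_logCounting_valueDivisor_le a
    exact ⟨-C, fun r hr ↦ by linarith [log_le_logCounting (valueDivisor_nonneg f a) h1 hr, hC r]⟩

lemma leUpTo_proximity_quotient (h : HasNonzeroDifference c f)
    (hl : IsGoodRadii (characteristic f ⊤) l) (a : ℂ) :
    LeUpTo l (characteristic f ⊤) (proximity (fun z ↦ (f (z + c) - a) / (f z - a)) ⊤) 0 := by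
  obtain ⟨C, hC⟩ := h.exists_characteristic_inv_sub_le a
  obtain ⟨K, hK⟩ := hl.exists_doubling
  set X : ℝ → ℝ := fun r ↦ characteristic (fun z ↦ f z - a) ⊤ (4 * r)
    + characteristic (fun z ↦ f z - a)⁻¹ ⊤ (4 * r)
  have h1 := hl.le_atTop (proximity_div_le_factor_mul (h.meromorphic_sub a)
    (h.meromorphicOrderAt_sub_ne_top a) h.separation_ne_zero)
  -- The two characteristics at 4r are at most 2 T(4r) + 2C ≤ 2K T(r) + 2C, and 2C ≤ T(r)
  -- eventually; hence 2K + 1.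
  refine (LeUpTo.of_le h1 hl.tendsto).trans (LeUpTo.mul_of_tendsto_zero (F := X) (B := 2 * K + 1)
    ((tendsto_differenceQuotientFactor c).mono_left hl.le_atTop) ?_ ?_ hl.tendsto)
  · filter_upwards [hl.le_atTop (eventually_ge_atTop (1 : ℝ))] with r hr
    exact add_nonneg (characteristic_nonneg (by linarith)) (characteristic_nonneg (by linarith))
  · filter_upwards [hK, hl.tendsto.eventually_ge_atTop (2 * C)] with r hr hrC
    have h2 := (abs_le.1 (hC (4 * r)).1).1
    have h3 := (abs_le.1 (hC (4 * r)).2).1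
    simp only [X]
    linarith

lemma leUpTo_logCounting_translateAdd (hl : IsGoodRadii (characteristic f ⊤) l) (d : ℂ)
    {D : Function.locallyFinsupp ℂ ℤ} (hD : 0 ≤ D) {C : ℝ}
    (hC : ∀ᶠ r in atTop, Function.locallyFinsuppWithin.logCounting D r ≤ characteristic f ⊤ r + C) :
    LeUpTo l (characteristic f ⊤) (Function.locallyFinsuppWithin.logCounting (translateAdd d D))
      (Function.locallyFinsuppWithin.logCounting D) := by
  obtain ⟨C', hC'⟩ := exists_logCounting_translateAdd_le d D hD
  obtain ⟨K, hK⟩ := hl.exists_doubling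
  have hT := hl.tendsto
  have t1 : Tendsto (fun r : ℝ ↦ 2 / log r) l (𝓝 0) :=
    (tendsto_const_nhds.div_atTop tendsto_log_atTop).mono_left hl.le_atTop
  have t2 : Tendsto (fun r : ℝ ↦ 2 * ‖d‖ / √r / log 2) l (𝓝 0) := by
    have : Tendsto (fun r : ℝ ↦ 2 * ‖d‖ / √r / log 2) atTop (𝓝 (0 / log 2)) :=
      (tendsto_const_nhds.div_atTop tendsto_sqrt_atTop).div_const _
    rw [zero_div] at this
    exact this.mono_left hl.le_atTop
  have h4 : Tendsto (fun r : ℝ ↦ 4 * r) atTop atTop :=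
    tendsto_id.const_mul_atTop (by norm_num : (0 : ℝ) < 4)
  have e1 : LeUpTo l (characteristic f ⊤)
      (fun r ↦ 2 / log r * Function.locallyFinsuppWithin.logCounting D r) 0 := by
    refine LeUpTo.mul_of_tendsto_zero (B := 2) t1 ?_ ?_ hT
    · filter_upwards [hl.le_atTop (eventually_ge_atTop (1 : ℝ))] with r hr
        using Function.locallyFinsuppWithin.logCounting_nonneg hD hr
    · filter_upwards [hl.le_atTop hC, hT.eventually_ge_atTop C] with r h1 h2
      linarith
  have e2 : LeUpTo l (characteristic f ⊤)
      (fun r ↦ 2 * ‖d‖ / √r / log 2 * Function.locallyFinsuppWithin.logCounting D (4 * r)) 0 := by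
    refine LeUpTo.mul_of_tendsto_zero (B := K + 1) t2 ?_ ?_ hT
    · filter_upwards [hl.le_atTop (eventually_ge_atTop (1 : ℝ))] with r hr
        using Function.locallyFinsuppWithin.logCounting_nonneg hD (by linarith)
    · filter_upwards [hl.le_atTop (h4.eventually hC), hT.eventually_ge_atTop C, hK] with r h1 h2 h3
      linarith
  refine LeUpTo.trans (G := fun r ↦ Function.locallyFinsuppWithin.logCounting D r
    + (2 / log r * Function.locallyFinsuppWithin.logCounting D r
      + 2 * ‖d‖ / √r / log 2 * Function.locallyFinsuppWithin.logCounting D (4 * r))) ?_ ?_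
  · refine LeUpTo.of_le_add_const (C := C') ?_ hT
    filter_upwards [hl.le_atTop hC'] with r hr
    linarith
  · have := (LeUpTo.of_le (F := Function.locallyFinsuppWithin.logCounting D)
      (Eventually.of_forall fun _ ↦ le_rfl) hT).add (e1.add e2)
    simpa using this

/-- If all points of a divisor come in pairs, then at least half of its points start a pair. -/
lemma leUpTo_logCounting_pairDivisor (hl : IsGoodRadii (characteristic f ⊤) l)
    {D : Function.locallyFinsupp ℂ ℤ} (hD : 0 ≤ D) {C : ℝ}
    (hC : ∀ᶠ r in atTop, Function.locallyFinsuppWithin.logCounting D r ≤ characteristic f ⊤ r + C)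
    (hpair : D ≤ pairDivisor c D + translateAdd (-c) (pairDivisor c D)) :
    LeUpTo l (characteristic f ⊤) (Function.locallyFinsuppWithin.logCounting D)
      (fun r ↦ 2 * Function.locallyFinsuppWithin.logCounting (pairDivisor c D) r) := by
  have h1 : LeUpTo l (characteristic f ⊤)
      (Function.locallyFinsuppWithin.logCounting (translateAdd (-c) (pairDivisor c D)))
      (Function.locallyFinsuppWithin.logCounting (pairDivisor c D)) := by
    refine leUpTo_logCounting_translateAdd hl (-c) (pairDivisor_nonneg c hD) (C := C) ?_
    filter_upwards [hC, eventually_ge_atTop 1] with r hr hr1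
    exact (Function.locallyFinsuppWithin.logCounting_le (pairDivisor_le c D) hr1).trans hr
  intro ε hε
  filter_upwards [h1 ε hε, hl.le_atTop (eventually_ge_atTop (1 : ℝ))] with r hr hr1
  have h2 := Function.locallyFinsuppWithin.logCounting_le hpair hr1
  rw [map_add, Pi.add_apply] at h2
  linarith

end HasNonzeroDifference

end GoodRadii

/-! ### The second main theorem for differences, and the count of paired values. -/

section SecondMainTheorem

open Real Metric Set Topology MeromorphicOn ValueDistribution Function.locallyFinsuppWithin

lemma exists_pos_forall_two_mul_le_norm_sub (A : Finset ℂ) :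
    ∃ d > 0, ∀ a ∈ A, ∀ b ∈ A, a ≠ b → 2 * d ≤ ‖a - b‖ := by
  have h : ∀ᶠ d : ℝ in 𝓝[>] 0, ∀ p ∈ A.offDiag, 2 * d ≤ ‖p.1 - p.2‖ := by
    rw [Finset.eventually_all]
    intro p hp
    have hne := (Finset.mem_offDiag.1 hp).2.2
    have hpos : 0 < ‖p.1 - p.2‖ / 2 := half_pos (norm_pos_iff.2 (sub_ne_zero.2 hne))
    filter_upwards [nhdsWithin_le_nhds (Iio_mem_nhds hpos)] with d hd
    have : d < ‖p.1 - p.2‖ / 2 := hd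
    linarith
  obtain ⟨d, hd, hd0⟩ := (h.and self_mem_nhdsWithin).exists
  exact ⟨d, hd0, fun a ha b hb hab ↦ hd (a, b) (Finset.mem_offDiag.2 ⟨ha, hb, hab⟩)⟩

/-- A point is close to at most one of finitely many values. -/
lemma exists_sum_posLog_norm_inv_sub_le (A : Finset ℂ) :
    ∃ C, ∀ w δ : ℂ, δ ≠ 0 → ∑ a ∈ A, log⁺ ‖(w - a)⁻¹‖
      ≤ log⁺ ‖δ⁻¹‖ + ∑ a ∈ A, log⁺ ‖δ / (w - a)‖ + C := by
  obtain ⟨d, hd, hA⟩ := exists_pos_forall_two_mul_le_norm_sub A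
  refine ⟨A.card * log⁺ d⁻¹, fun w δ hδ ↦ ?_⟩
  have hfar {a : ℂ} (ha : d ≤ ‖w - a‖) : log⁺ ‖(w - a)⁻¹‖ ≤ log⁺ d⁻¹ := by
    rw [norm_inv]
    apply posLog_le_posLog (by positivity)
    gcongr
  have hS : 0 ≤ ∑ a ∈ A, log⁺ ‖δ / (w - a)‖ := Finset.sum_nonneg fun _ _ ↦ posLog_nonneg
  have hδ' : 0 ≤ log⁺ ‖δ⁻¹‖ := posLog_nonneg
  by_cases hex : ∃ a ∈ A, ‖w - a‖ < d
  · obtain ⟨a, ha, hwa⟩ := hex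
    rw [← Finset.add_sum_erase A _ ha]
    refine add_le_add ?_ ?_
    · have e : (w - a)⁻¹ = δ⁻¹ * (δ / (w - a)) := by
        rw [← mul_div_assoc, inv_mul_cancel₀ hδ, one_div]
      rw [e, norm_mul]
      refine posLog_mul.trans (add_le_add le_rfl ?_)
      exact Finset.single_le_sum (f := fun a ↦ log⁺ ‖δ / (w - a)‖) (fun _ _ ↦ posLog_nonneg) ha
    · calc ∑ b ∈ A.erase a, log⁺ ‖(w - b)⁻¹‖ ≤ ∑ b ∈ A.erase a, log⁺ d⁻¹ := by
            refine Finset.sum_le_sum fun b hb ↦ hfar ?_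
            have h1 := hA a ha b (Finset.mem_of_mem_erase hb) (Finset.ne_of_mem_erase hb).symm
            have h2 : ‖a - b‖ ≤ ‖w - b‖ + ‖w - a‖ := by
              have := norm_sub_le (w - b) (w - a)
              rwa [sub_sub_sub_cancel_left] at this
            linarith
        _ ≤ ∑ b ∈ A, log⁺ d⁻¹ := Finset.sum_le_sum_of_subset_of_nonneg (Finset.erase_subset a A)
            fun _ _ _ ↦ posLog_nonneg
        _ = _ := by simp
  · push Not at hex
    have h1 : ∑ a ∈ A, log⁺ ‖(w - a)⁻¹‖ ≤ ∑ a ∈ A, log⁺ d⁻¹ :=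
      Finset.sum_le_sum fun a ha ↦ hfar (hex a ha)
    simp only [Finset.sum_const, nsmul_eq_mul] at h1
    linarith

lemma posLog_norm_sub_div_le (x y : ℂ) : log⁺ ‖(x - y) / y‖ ≤ log⁺ ‖x / y‖ + log 2 := by
  have hlog2 : 0 ≤ log 2 := log_nonneg (by norm_num)
  by_cases hy : y = 0
  · simp [hy, hlog2]
  · have e : (x - y) / y = x / y + (-1) := by field_simp; ring
    rw [e]
    refine (posLog_norm_add_le _ _).trans ?_
    simp

namespace HasNonzeroDifference

variable {c : ℂ} {f : ℂ → ℂ} {l : Filter ℝ}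

lemma meromorphic_quotient (h : HasNonzeroDifference c f) (a : ℂ) :
    Meromorphic (fun z ↦ (f (z + c) - a) / (f z - a)) :=
  ((h.meromorphic_sub a).comp_add_const c).div (h.meromorphic_sub a)

/-- The pointwise bound with w = f(z) and δ = Δ_c f(z), averaged over the circle; the zeros of Δ_c f
form a negligible set. -/
lemma exists_sum_proximity_inv_le (h : HasNonzeroDifference c f) (A : Finset ℂ) :
    ∃ C, ∀ r ≠ 0, ∑ a ∈ A, proximity (fun z ↦ f z - a)⁻¹ ⊤ r
      ≤ proximity (exactDifference c f)⁻¹ ⊤ r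
        + ∑ a ∈ A, proximity (fun z ↦ (f (z + c) - a) / (f z - a)) ⊤ r + C := by
  obtain ⟨C, hC⟩ := exists_sum_posLog_norm_inv_sub_le A
  refine ⟨A.card * log 2 + C, fun r hr ↦ ?_⟩
  have I1 : ∀ a ∈ A, CircleIntegrable (fun z ↦ log⁺ ‖(f z - a)⁻¹‖) 0 r := fun a _ ↦
    (h.meromorphic_sub a).inv.meromorphicOn.circleIntegrable_posLog_norm
  have I2 : CircleIntegrable (fun z ↦ log⁺ ‖(exactDifference c f z)⁻¹‖) 0 r :=
    h.meromorphic_difference.inv.meromorphicOn.circleIntegrable_posLog_norm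
  have I3 : ∀ a ∈ A, CircleIntegrable (fun z ↦ log⁺ ‖(f (z + c) - a) / (f z - a)‖) 0 r := fun a _ ↦
    (h.meromorphic_quotient a).meromorphicOn.circleIntegrable_posLog_norm
  have sum_fun (F : ℂ → ℂ → ℝ) (hF : ∀ a ∈ A, CircleIntegrable (F a) 0 r) :
      CircleIntegrable (fun z ↦ ∑ a ∈ A, F a z) 0 r := by
    have := CircleIntegrable.sum A hF
    rwa [show (∑ a ∈ A, F a) = fun z ↦ ∑ a ∈ A, F a z by ext z; simp] at this
  have I1' := sum_fun _ I1
  have I3' := sum_fun _ I3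
  have key : circleAverage (fun z ↦ ∑ a ∈ A, log⁺ ‖(f z - a)⁻¹‖) 0 r
      ≤ circleAverage (fun z ↦ log⁺ ‖(exactDifference c f z)⁻¹‖
        + ∑ a ∈ A, log⁺ ‖(f (z + c) - a) / (f z - a)‖ + (A.card * log 2 + C)) 0 r := by
    apply circleAverage_mono_codiscreteWithin hr I1'
      ((I2.add I3').add (circleIntegrable_const _ 0 r))
    filter_upwards [h.meromorphic_difference.meromorphicOn.eventually_codiscreteWithin_apply_ne_zero
      (fun x _ ↦ h.meromorphicOrderAt_difference_ne_top x)] with z hz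
    refine (hC (f z) _ hz).trans ?_
    have : ∑ a ∈ A, log⁺ ‖exactDifference c f z / (f z - a)‖
        ≤ ∑ a ∈ A, (log⁺ ‖(f (z + c) - a) / (f z - a)‖ + log 2) := by
      refine Finset.sum_le_sum fun a _ ↦ ?_
      have := posLog_norm_sub_div_le (f (z + c) - a) (f z - a)
      rwa [sub_sub_sub_cancel_right] at this
    rw [Finset.sum_add_distrib, Finset.sum_const, nsmul_eq_mul] at this
    simp only [Pi.add_apply]
    linarith
  have I23 : CircleIntegrable (fun z ↦ log⁺ ‖(exactDifference c f z)⁻¹‖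
    + ∑ a ∈ A, log⁺ ‖(f (z + c) - a) / (f z - a)‖) 0 r := I2.add I3'
  rw [circleAverage_fun_add I23 (circleIntegrable_const _ 0 r), circleAverage_fun_add I2 I3',
    circleAverage_const, circleAverage_fun_sum I1,
    circleAverage_fun_sum I3] at key
  simpa only [proximity_top, Pi.inv_apply] using key

/-- Here Δ_c f = f · (f(z + c)/f(z) - 1). The subtracted zeros keep the quotient in the form used
for general a. -/
lemma proximity_difference_le (h : HasNonzeroDifference c f) {r : ℝ} (hr : r ≠ 0) :
    proximity (exactDifference c f) ⊤ r ≤ proximity f ⊤ r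
      + proximity (fun z ↦ (f (z + c) - 0) / (f z - 0)) ⊤ r + log 2 := by
  have I1 : CircleIntegrable (fun z ↦ log⁺ ‖exactDifference c f z‖) 0 r :=
    h.meromorphic_difference.meromorphicOn.circleIntegrable_posLog_norm
  have I2 : CircleIntegrable (fun z ↦ log⁺ ‖f z‖) 0 r :=
    h.meromorphic.meromorphicOn.circleIntegrable_posLog_norm
  have I3 : CircleIntegrable (fun z ↦ log⁺ ‖(f (z + c) - 0) / (f z - 0)‖) 0 r :=
    (h.meromorphic_quotient 0).meromorphicOn.circleIntegrable_posLog_norm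
  have I23 : CircleIntegrable (fun z ↦ log⁺ ‖f z‖
    + log⁺ ‖(f (z + c) - 0) / (f z - 0)‖) 0 r := I2.add I3
  simp only [proximity_top]
  rw [← circleAverage_const (log 2) 0 r, ← circleAverage_fun_add I2 I3,
    ← circleAverage_fun_add I23 (circleIntegrable_const _ 0 r)]
  apply circleAverage_mono_codiscreteWithin hr I1 ((I2.add I3).add (circleIntegrable_const _ 0 r))
  filter_upwards [h.meromorphic.meromorphicOn.eventually_codiscreteWithin_apply_ne_zero
    (fun x _ ↦ h.meromorphicOrderAt_ne_top x)] with z hz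
  have e : exactDifference c f z = f z * ((f (z + c) - f z) / f z) := by
    simp only [exactDifference]
    field_simp
  simp only [Pi.add_apply, sub_zero]
  rw [e, norm_mul]
  refine posLog_mul.trans ?_
  linarith [posLog_norm_sub_div_le (f (z + c)) (f z)]

/-- The second main theorem for the difference operator. -/
theorem leUpTo_secondMainTheorem (h : HasNonzeroDifference c f)
    (hl : IsGoodRadii (characteristic f ⊤) l) (A : Finset ℂ) :
    LeUpTo l (characteristic f ⊤)
      (fun r ↦ (A.card - 1) * characteristic f ⊤ r
        + Function.locallyFinsuppWithin.logCounting (pairDivisor c (poleDivisor f)) r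
        + ∑ a ∈ A, Function.locallyFinsuppWithin.logCounting (pairDivisor c (valueDivisor f a)) r)
      (fun r ↦ ∑ a ∈ A, Function.locallyFinsuppWithin.logCounting (valueDivisor f a) r
        + Function.locallyFinsuppWithin.logCounting (poleDivisor f) r) := by
  have hT := hl.tendsto
  obtain ⟨C₁, hC₁⟩ := h.exists_sum_proximity_inv_le A
  obtain ⟨C₂, hC₂⟩ := exists_characteristic_sub_characteristic_inv_le h.meromorphic_difference
  choose C₃ hC₃ using h.exists_characteristic_inv_sub_le
  set Q : ℂ → ℝ → ℝ := fun a ↦ proximity (fun z ↦ (f (z + c) - a) / (f z - a)) ⊤ with hQ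
  have hshift : LeUpTo l (characteristic f ⊤)
      (Function.locallyFinsuppWithin.logCounting (translateAdd c (poleDivisor f)))
      (Function.locallyFinsuppWithin.logCounting (poleDivisor f)) :=
    leUpTo_logCounting_translateAdd hl c (poleDivisor_nonneg f) (C := 0)
      (Eventually.of_forall fun r ↦ by simpa using logCounting_poleDivisor_le f r)
  have hQsum := (LeUpTo.sum A hT fun a _ ↦ h.leUpTo_proximity_quotient hl a).add
    (h.leUpTo_proximity_quotient hl 0)
  have hrest : LeUpTo l (characteristic f ⊤) (fun r ↦
      ∑ a ∈ A, Function.locallyFinsuppWithin.logCounting (valueDivisor f a) r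
      + (Function.locallyFinsuppWithin.logCounting (translateAdd c (poleDivisor f)) r
        + (∑ a ∈ A, Q a r + Q 0 r)))
      (fun r ↦ ∑ a ∈ A, Function.locallyFinsuppWithin.logCounting (valueDivisor f a) r
        + Function.locallyFinsuppWithin.logCounting (poleDivisor f) r) := by
    have := (LeUpTo.of_le (F := fun r ↦
      ∑ a ∈ A, Function.locallyFinsuppWithin.logCounting (valueDivisor f a) r)
      (Eventually.of_forall fun _ ↦ le_rfl) hT).add (hshift.add hQsum)
    simpa only [Pi.zero_apply, Finset.sum_const_zero, add_zero] using this
  refine (LeUpTo.of_le_add_const (C := C₁ + C₂ + log 2 + ∑ a ∈ A, C₃ a) ?_ hT).trans hrest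
  filter_upwards [hl.le_atTop (eventually_ge_atTop (1 : ℝ))] with r hr
  have hr0 : r ≠ 0 := by linarith
  -- Up to o(T), |A| T - ∑ N(a) is at most the proximity function of 1/Δ_c f, that is T(Δ_c f) minus
  -- the zero count of Δ_c f. Moreover T(Δ_c f) ≤ m(f) + 2N(∞) - P(∞) = T + N(∞) - P(∞), and the
  -- zero count is at least ∑ P(a).
  have i1 := hC₁ r hr0
  have i2 := h.proximity_difference_le hr0
  have i3 : A.card * characteristic f ⊤ r ≤ ∑ a ∈ A, proximity (fun z ↦ f z - a)⁻¹ ⊤ r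
      + ∑ a ∈ A, Function.locallyFinsuppWithin.logCounting (valueDivisor f a) r
      + ∑ a ∈ A, C₃ a := by
    rw [← nsmul_eq_mul, ← Finset.sum_const, ← Finset.sum_add_distrib, ← Finset.sum_add_distrib]
    refine Finset.sum_le_sum fun a _ ↦ ?_
    have h1 := (abs_le.1 (hC₃ a r).1).2
    have h2 : characteristic (fun z ↦ f z - a)⁻¹ ⊤ r = proximity (fun z ↦ f z - a)⁻¹ ⊤ r
      + ValueDistribution.logCounting (fun z ↦ f z - a)⁻¹ ⊤ r := rfl
    rw [logCounting_inv_top_eq_logCounting_valueDivisor] at h2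
    linarith
  have i4 := (abs_le.1 (hC₂ r)).1
  have e1 : characteristic (exactDifference c f) ⊤ r = proximity (exactDifference c f) ⊤ r
    + Function.locallyFinsuppWithin.logCounting (divisor (exactDifference c f) univ)⁻ r := by
    rw [← logCounting_top]; rfl
  have e2 : characteristic (exactDifference c f)⁻¹ ⊤ r = proximity (exactDifference c f)⁻¹ ⊤ r
    + Function.locallyFinsuppWithin.logCounting (divisor (exactDifference c f) univ)⁺ r := by
    rw [← logCounting_zero, ← logCounting_inv]; rfl
  have e3 : characteristic f ⊤ r = proximity f ⊤ r
    + Function.locallyFinsuppWithin.logCounting (poleDivisor f) r := by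
    rw [poleDivisor, ← logCounting_top]; rfl
  have i5 := Function.locallyFinsuppWithin.logCounting_le (h.sum_pairDivisor_le A) hr
  rw [map_sum, Finset.sum_apply] at i5
  have i6 := Function.locallyFinsuppWithin.logCounting_le
    h.negPart_divisor_difference_add_pairDivisor_le hr
  rw [map_add, map_add, Pi.add_apply, Pi.add_apply] at i6
  simp only [hQ]
  linarith

theorem encard_isCompletelyPaired_le (h : HasNonzeroDifference c f) (hf : IsOfFiniteOrder f) :
    {a : WithTop ℂ | IsCompletelyPaired f c a}.encard ≤ 4 := by
  by_contra! hcard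
  obtain ⟨t, ht, htcard⟩ := Set.exists_subset_encard_eq (Order.add_one_le_of_lt hcard)
  have htfin : t.Finite := Set.finite_of_encard_eq_coe (k := 5) (by rw [htcard]; norm_num)
  lift t to Finset (WithTop ℂ) using htfin
  have htcard' : t.card = 5 := by
    rw [Set.encard_coe_eq_coe_finsetCard] at htcard
    exact_mod_cast htcard
  classical
  set A : Finset ℂ := Finset.eraseNone t
  have hAp : ∀ a ∈ A, IsCompletelyPaired f c (a : WithTop ℂ) := fun a ha ↦
    ht (Finset.mem_eraseNone.1 ha)
  obtain ⟨N, hN⟩ := hf.exists_le_pow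
  obtain ⟨l, hl⟩ := exists_isGoodRadii h.tendsto_characteristic hN
  have := hl.neBot
  -- Both cases below leave a margin of T / 2, so any small ε suffices.
  have hε : (0 : ℝ) < 1 / 100 := by norm_num
  have smt := h.leUpTo_secondMainTheorem hl A _ hε
  have hpairs := LeUpTo.sum A hl.tendsto (fun a ha ↦ by
    obtain ⟨C, hC⟩ := h.exists_logCounting_valueDivisor_le a
    exact leUpTo_logCounting_pairDivisor hl (valueDivisor_nonneg f a) (Eventually.of_forall hC)
      (h.valueDivisor_le_of_isCompletelyPaired (hAp a ha))) _ hε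
  have hvalue := LeUpTo.sum A hl.tendsto (fun a _ ↦ by
    obtain ⟨C, hC⟩ := h.exists_logCounting_valueDivisor_le a
    exact LeUpTo.of_le_add_const (Eventually.of_forall hC) hl.tendsto) _ hε
  by_cases htop : (⊤ : WithTop ℂ) ∈ t
  · have hcardA : A.card = 4 := by
      have : A.card = t.card - 1 := Finset.card_eraseNone_of_mem htop
      omega
    have hpole := leUpTo_logCounting_pairDivisor hl (poleDivisor_nonneg f) (C := 0)
      (Eventually.of_forall fun r ↦ by simpa using logCounting_poleDivisor_le f r)
      (h.poleDivisor_le_of_isCompletelyPaired (ht htop)) _ hε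
    obtain ⟨r, h1, h2, h3, h4, h5⟩ := (smt.and (hpairs.and (hvalue.and (hpole.and
      (hl.tendsto.eventually_gt_atTop 0))))).exists
    simp only [← Finset.mul_sum, Finset.sum_const, hcardA] at h1 h2 h3
    have h6 := logCounting_poleDivisor_le f r
    norm_num at h1 h3
    linarith
  · have hcardA : A.card = 5 := by
      have : A.card = t.card := Finset.card_eraseNone_of_not_mem htop
      omega
    have hge : ∀ᶠ r in l, (1 : ℝ) ≤ r := hl.le_atTop (eventually_ge_atTop 1)
    obtain ⟨r, h1, h2, h3, h4, h5⟩ := (smt.and (hpairs.and (hvalue.and (hge.and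
      (hl.tendsto.eventually_gt_atTop 0))))).exists
    simp only [← Finset.mul_sum, Finset.sum_const, hcardA] at h1 h2 h3
    have h6 := logCounting_poleDivisor_le f r
    have h7 := Function.locallyFinsuppWithin.logCounting_nonneg
      (pairDivisor_nonneg c (poleDivisor_nonneg f)) h4
    norm_num at h1 h3
    linarith

end HasNonzeroDifference

end SecondMainTheorem

theorem mainTheorem6 (c : ℂ) (f : ℂ → ℂ) (hf : Meromorphic f) (hord : IsOfFiniteOrder f)
    (hΔ : ¬ exactDifference c f =ᶠ[codiscrete ℂ] 0) :
    {a : WithTop ℂ | IsCompletelyPaired f c a}.encard ≤ 4 :=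
  HasNonzeroDifference.encard_isCompletelyPaired_le ⟨hf, hΔ⟩ hord
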